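/- Let $g',g,d',d\ge 1$ be integers. For $p,q\ge 0$ and $n\ge1$ identify $(\mathbb C^{n\times n})^{p\times q}$ with $\mathbb C^{pn\times qn}$ (block matrices) and let $\|\cdot\|$ be the operator norm. Let $\operatorname{int}\mathcal B_{p\times q}$ (resp. $\mathcal B_{p\times q}$) be the disjoint union over $n\ge 1$ of the sets of $X\in(\mathbb C^{n\times n})^{p\times q}$ with $\|X\|<1$ (resp. $\|X\|\le 1$). An \emph{NC analytic map} $f:\mathcal B_{g'\times g}\to\bigcup_n(\mathbb C^{n\times n})^{p\times q}$ is a function $f$ on $\operatorname{int}\mathcal B_{g'\times g}$ which sends $n\times n$ blocks to $n\times n$ blocks, such that: (1) there are coefficients $a_w\in\mathbb C^{p\times q}$, indexed by the words $w$ in $g'g$ noncommuting letters $x_{ij}$, and an $\varepsilon>0$ such that $f(X)=\sum_{\alpha=0}^\infty\sum_{|w|=\alpha}a_w\otimes w(X)$ (convergence of the series over $\alpha$) for all $X\in\operatorname{int}\mathcal B_{g'\times g}$ of any level $n$ with $\|X\|<\varepsilon$; (2) for every $n$ and every analytic map $a$ from a domain $W\subseteq\mathbb C^M$ into the level $n$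 of $\operatorname{int}\mathcal B_{g'\times g}$, the composition $f\circ a$ is analytic on $W$, and it is continuous on $\overline W$ if $a$ is a continuous map from $\overline W$ into the level $n$ of $\operatorname{int}\mathcal B_{g'\times g}$. It is \emph{contraction-valued} if $\|f(X)\|\le 1$ for all $X\in\operatorname{int}\mathcal B_{g'\times g}$; we then write $f:\mathcal B_{g'\times g}\to\mathcal B_{p\times q}$. An \emph{NC ball map} $f:\mathcal B_{g'\times g}\to\mathcal B_{p\times q}$ is a contraction-valued NC analytic map which maps the boundary to the boundary: whenever $\|X\|=1$, $t\in\mathbb R$ and the limit $L=\lim_{r\nearrow1}f(re^{it}X)$ exists, then $\|L\|=1$. \textbf{Theorem.} Let $h:\mathcal B_{g'\times g}\to\mathcal B_{d'\times d}$ be an NC ball map with $h(0)=0$ (at every level). Then $g'\le d'$ and $g\le d$, and there exist unitary matrices $U\in\mathbb C^{d\times d}$, $V\in\mathbb C^{d'\times d'}$ and a contraction-valued NC analytic map $\tilde h:\mathcal B_{g'\times g}\to\mathcal B_{(d'-g')\times(d-g)}$ with $\tilde h(0)=0$ such that $$h(x)=V\begin{bmatrix}x&0\\0&\tilde h(x)\end{bmatrix}U^*,$$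 that is, $h(X)=(V\otimes I_n)\begin{bmatrix}X&0\\0&\tilde h(X)\end{bmatrix}(U\otimes I_n)^*$ for all $n\ge1$ and all $X\in(\mathbb C^{n\times n})^{g'\times g}$ with $\|X\|<1$. Conversely, if $g'\le d'$ and $g\le d$, then every map $h$ on $\operatorname{int}\mathcal B_{g'\times g}$ of this form, with $U,V$ unitary and $\tilde h$ a contraction-valued NC analytic map with $\tilde h(0)=0$, is an NC ball map $\mathcal B_{g'\times g}\to\mathcal B_{d'\times d}$ with $h(0)=0$. -/

import Mathlib

open scoped Matrix.Norms.L2Operator Kronecker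

noncomputable section

namespace NCBall

/-- `p × q` matrices whose entries are complex `n × n` matrices, written as `pn × qn` block
matrices. By the opened scope `‖X‖` is the operator norm of `X : ℂ^{qn} → ℂ^{pn}` for the
Euclidean norms. The level `n = 0` is a one-point space, on which all conditions below hold
trivially, so it plays no role. -/
abbrev OpSpace (p q n : ℕ) : Type := Matrix (Fin p × Fin n) (Fin q × Fin n) ℂ

/-- Level `n` of the open ball: the matrices with `‖X‖ < 1` (that is, `I - X^* X ≻ 0`). -/
def openBall (p q n : ℕ) : Set (OpSpace p q n) := {X | ‖X‖ < 1}

/-- The `n × n` block of `X` at the position `ij`. -/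
def block {p q n : ℕ} (X : OpSpace p q n) (ij : Fin p × Fin q) : Matrix (Fin n) (Fin n) ℂ :=
  Matrix.of fun s t => X (ij.1, s) (ij.2, t)

/-- The value `w(X)` of a word `w` in the letters `x_{ij}`. -/
def wordEval {p q n : ℕ} (X : OpSpace p q n) (w : FreeMonoid (Fin p × Fin q)) :
    Matrix (Fin n) (Fin n) ℂ :=
  FreeMonoid.lift (block X) w

/-- The homogeneous part of degree `k`, `∑_{|w| = k} a_w ⊗ w(X)`, of the NC power series
`∑_w a_w w`. Words of length `k` are listed by their letters `v : Fin k → _`. -/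
def homogPart {g' g d' d : ℕ}
    (a : FreeMonoid (Fin g' × Fin g) → Matrix (Fin d') (Fin d) ℂ) (k : ℕ)
    {n : ℕ} (X : OpSpace g' g n) : OpSpace d' d n :=
  ∑ v : Fin k → Fin g' × Fin g,
    a (FreeMonoid.ofList (List.ofFn v)) ⊗ₖ wordEval X (FreeMonoid.ofList (List.ofFn v))

/-- A level-preserving function, of which only the values on the open ball matter. -/
abbrev NCFun (g' g d' d : ℕ) : Type := ∀ n : ℕ, OpSpace g' g n → OpSpace d' d n

/-- `f` is an NC analytic function on the open ball: it has an NC power series converging to it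
(summed by homogeneous parts) on a neighborhood of `0` of a radius not depending on the level,
and composing `f` with an analytic map `a` from a domain `W ⊆ ℂ^M` into the ball gives
an analytic map on `W`, which extends continuously to the boundary of `W` whenever `a` does
so as a map into the open ball. -/
structure IsNCAnalytic {g' g d' d : ℕ} (f : NCFun g' g d' d) : Prop where
  series : ∃ a : FreeMonoid (Fin g' × Fin g) → Matrix (Fin d') (Fin d) ℂ, ∃ ε : ℝ, 0 < ε ∧
    ∀ (n : ℕ) (X : OpSpace g' g n), X ∈ openBall g' g n → ‖X‖ < ε →
      Filter.Tendsto (fun K : ℕ => ∑ k ∈ Finset.range K, homogPart a k X) Filter.atTop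
        (nhds (f n X))
  comp : ∀ (n M : ℕ) (W : Set (Fin M → ℂ)) (a : (Fin M → ℂ) → OpSpace g' g n),
    IsOpen W → IsConnected W → Set.MapsTo a W (openBall g' g n) → DifferentiableOn ℂ a W →
      DifferentiableOn ℂ (fun w => f n (a w)) W ∧
      (ContinuousOn a (closure W) → Set.MapsTo a (closure W) (openBall g' g n) →
        ContinuousOn (fun w => f n (a w)) (closure W))

/-- `f` maps the open ball to the closed unit ball. -/
def IsContractionValued {g' g d' d : ℕ} (f : NCFun g' g d' d) : Prop :=
  ∀ (n : ℕ) (X : OpSpace g' g n), X ∈ openBall g' g n → ‖f n X‖ ≤ 1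

/-- `f` maps the boundary to the boundary: if `‖X‖ = 1` and the radial limit
`L = lim_{r ↗ 1} f (r e^{it} X)` exists, then `‖L‖ = 1`. -/
def MapsBoundaryToBoundary {g' g d' d : ℕ} (f : NCFun g' g d' d) : Prop :=
  ∀ (n : ℕ) (X : OpSpace g' g n), ‖X‖ = 1 → ∀ (t : ℝ) (L : OpSpace d' d n),
    Filter.Tendsto (fun r : ℝ => f n (((r : ℂ) * Complex.exp (Complex.I * (t : ℂ))) • X))
      (nhdsWithin 1 (Set.Iio 1)) (nhds L) → ‖L‖ = 1

/-- NC ball maps. -/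
structure IsNCBallMap {g' g d' d : ℕ} (f : NCFun g' g d' d) : Prop where
  analytic : IsNCAnalytic f
  contractive : IsContractionValued f
  boundary : MapsBoundaryToBoundary f

/-- `f(0) = 0`. -/
def FixesZero {g' g d' d : ℕ} (f : NCFun g' g d' d) : Prop := ∀ n : ℕ, f n 0 = 0

/-- The identification of the row (column) indices of `[X 0; 0 Y]` with `Fin b × Fin n`:
the first `m` blocks come from `X`, the last `b - m` from `Y`. -/
def splitEquiv {m b : ℕ} (h : m ≤ b) (n : ℕ) :
    (Fin m × Fin n) ⊕ (Fin (b - m) × Fin n) ≃ Fin b × Fin n :=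
  (Equiv.sumProdDistrib (Fin m) (Fin (b - m)) (Fin n)).symm.trans
    (Equiv.prodCongr (finSumFinEquiv.trans (finCongr (Nat.add_sub_of_le h))) (Equiv.refl _))

/-- The block diagonal matrix `[X 0; 0 Y]`. -/
def blockDiag {g' g d' d n : ℕ} (h' : g' ≤ d') (h : g ≤ d) (X : OpSpace g' g n)
    (Y : OpSpace (d' - g') (d - g) n) : OpSpace d' d n :=
  Matrix.reindex (splitEquiv h' n) (splitEquiv h n) (Matrix.fromBlocks X 0 0 Y)

/-- A scalar matrix `A` acting at level `n`, that is `A ⊗ I_n`. -/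
def ampl {p : ℕ} (A : Matrix (Fin p) (Fin p) ℂ) (n : ℕ) : OpSpace p p n :=
  A ⊗ₖ (1 : Matrix (Fin n) (Fin n) ℂ)

end NCBall

end

/-!
An NC ball map `h` with `h(0) = 0` is determined near `0` by the coefficients `a_w` of its power
series, and these are read off at nilpotent points `X`, where all long words vanish. There
`z ↦ h(zX)` is a polynomial on the whole disc, so radial limits exist without any boundary theory:
contractivity of `h` makes the finite sum `∑_k homogPart a k X` a contraction whenever `‖X‖ ≤ 1`
(`IsNCAnalytic.contractiveSeries`), and the boundary condition makes it have norm `1` whenever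
`‖X‖ = 1` (`IsNCBallMap.norm_partialSum`).

Two families of nilpotent points suffice.

* Compressed creation operators (`treeShift`). A finite set `S` of words closed under dropping
  the first letter, in which no two words differ exactly in the row index of the first letter,
  gives a contraction at which the series yields Bessel's inequality
  `∑_{w ∈ S} ‖a_w p‖² ≤ ‖p‖²` (`ContractiveSeries.bessel`). Hence, if all `a_{x_{ij}}` with a
  fixed `j` preserve the norm of `p`, then `a_w p = 0` for all words `w` other than these letters
  and the empty word (`ContractiveSeries.coeff_apply_eq_zero`). The adjoint series
  `X ↦ h(X^*)^*` gives the same for rows.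
* A rank one point (`rankOnePoint`). The linear part is isometric there, and the equality case of
  the triangle and Cauchy–Schwarz inequalities at a vector attaining the norm provides unit
  vectors `p_j`, `q_i` with `a_{x_{ij}} p_j = q_i` for all `i`, `j`.

Together these show that `p` and `q` are orthonormal, which forces `g ≤ d` and `g' ≤ d'`, and that
after extending them to unitaries `U` and `V` every `V^* a_w U` is block diagonal, with the
coefficient of the series `x` in the upper left corner (`IsNCBallMap.exists_coeff_eq`). This gives
the block diagonal form of `h` near `0`, and the identity theorem on the discs `z ↦ zX` extends it
to the whole ball. Conversely, `‖X‖ ≤ ‖h(X)‖ ≤ 1` for `h` of that form, so the boundary is mapped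
to the boundary.
-/

noncomputable section

namespace NCBall

open Matrix

variable {g' g d' d n : ℕ}

/-! ### Power series at nilpotent points -/

lemma wordEval_ofList (X : OpSpace g' g n) (l : List (Fin g' × Fin g)) :
    wordEval X (FreeMonoid.ofList l) = (l.map (block X)).prod := by
  rw [wordEval, FreeMonoid.lift_ofList]

lemma homogPart_apply (a : FreeMonoid (Fin g' × Fin g) → Matrix (Fin d') (Fin d) ℂ) (k : ℕ)
    (X : OpSpace g' g n) (r : Fin d' × Fin n) (c : Fin d × Fin n) :
    homogPart a k X r c = ∑ v : Fin k → Fin g' × Fin g,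
      a (FreeMonoid.ofList (List.ofFn v)) r.1 c.1 *
        wordEval X (FreeMonoid.ofList (List.ofFn v)) r.2 c.2 := by
  simp [homogPart, Matrix.sum_apply, Matrix.kroneckerMap_apply]

lemma block_smul (z : ℂ) (X : OpSpace g' g n) : block (z • X) = z • block X := by
  ext ij s t; simp [block]

lemma wordEval_smul (z : ℂ) (X : OpSpace g' g n) (l : List (Fin g' × Fin g)) :
    wordEval (z • X) (FreeMonoid.ofList l) = z ^ l.length • wordEval X (FreeMonoid.ofList l) := by
  simp only [wordEval_ofList]
  induction l with
  | nil => simp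
  | cons x l ih =>
    rw [List.map_cons, List.prod_cons, ih, List.length_cons, List.map_cons, List.prod_cons,
      block_smul, Pi.smul_apply, smul_mul_smul_comm, pow_succ']

lemma homogPart_smul (a : FreeMonoid (Fin g' × Fin g) → Matrix (Fin d') (Fin d) ℂ) (k : ℕ)
    (z : ℂ) (X : OpSpace g' g n) : homogPart a k (z • X) = z ^ k • homogPart a k X := by
  simp only [homogPart, wordEval_smul, List.length_ofFn, Matrix.kronecker_smul, Finset.smul_sum]

lemma homogPart_zero_arg (a : FreeMonoid (Fin g' × Fin g) → Matrix (Fin d') (Fin d) ℂ) {k : ℕ}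
    (hk : k ≠ 0) : homogPart a k (0 : OpSpace g' g n) = 0 := by
  simpa [hk] using homogPart_smul a k 0 (0 : OpSpace g' g n)

lemma homogPart_degree_zero (a : FreeMonoid (Fin g' × Fin g) → Matrix (Fin d') (Fin d) ℂ)
    (X : OpSpace g' g n) : homogPart a 0 X = a 1 ⊗ₖ (1 : Matrix (Fin n) (Fin n) ℂ) := by
  simp [homogPart, wordEval]

lemma homogPart_degree_one_apply (a : FreeMonoid (Fin g' × Fin g) → Matrix (Fin d') (Fin d) ℂ)
    (X : OpSpace g' g n) (r : Fin d' × Fin n) (c : Fin d × Fin n) :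
    homogPart a 1 X r c =
      ∑ x : Fin g' × Fin g, a (FreeMonoid.ofList [x]) r.1 c.1 * X (x.1, r.2) (x.2, c.2) := by
  rw [homogPart_apply, ← (Equiv.funUnique (Fin 1) (Fin g' × Fin g)).symm.sum_comp]
  simp [wordEval, block]

/-- All words of length at least `N` vanish at `X`, so that NC power series are polynomials
along the ray through `X`. -/
def WordsVanish (N : ℕ) (X : OpSpace g' g n) : Prop :=
  ∀ l : List (Fin g' × Fin g), N ≤ l.length → wordEval X (FreeMonoid.ofList l) = 0

lemma WordsVanish.homogPart_eq_zero {N k : ℕ} {X : OpSpace g' g n} (hX : WordsVanish N X)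
    (a : FreeMonoid (Fin g' × Fin g) → Matrix (Fin d') (Fin d) ℂ) (hk : N ≤ k) :
    homogPart a k X = 0 := by
  simp [homogPart, hX _ ((List.length_ofFn (n := k)).symm ▸ hk)]

/-- The sum of the homogeneous parts of degree less than `N` of an NC power series. -/
def partialSum (a : FreeMonoid (Fin g' × Fin g) → Matrix (Fin d') (Fin d) ℂ) (N : ℕ)
    (X : OpSpace g' g n) : OpSpace d' d n := ∑ k ∈ Finset.range N, homogPart a k X

/-- An NC power series is contractive if its values at all jointly nilpotent contractions are
contractions; at such points no convergence question arises. -/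
def ContractiveSeries (a : FreeMonoid (Fin g' × Fin g) → Matrix (Fin d') (Fin d) ℂ) : Prop :=
  ∀ (n N : ℕ) (X : OpSpace g' g n), WordsVanish N X → ‖X‖ ≤ 1 → ‖partialSum a N X‖ ≤ 1

/-- The series `a` sums up to `f` on the part of radius `ε` of the ball, at every level. -/
def HasSeries (f : NCFun g' g d' d) (a : FreeMonoid (Fin g' × Fin g) → Matrix (Fin d') (Fin d) ℂ)
    (ε : ℝ) : Prop :=
  ∀ (n : ℕ) (X : OpSpace g' g n), X ∈ openBall g' g n → ‖X‖ < ε →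
    Filter.Tendsto (fun K : ℕ => ∑ k ∈ Finset.range K, homogPart a k X) Filter.atTop
      (nhds (f n X))

/-! ### Analytic continuation along complex lines -/

lemma IsNCAnalytic.differentiableOn_line {f : NCFun g' g d' d} (hf : IsNCAnalytic f)
    (X : OpSpace g' g n) :
    DifferentiableOn ℂ (fun z : ℂ => f n (z • X)) {z : ℂ | ‖z • X‖ < 1} := by
  let W : Set (Fin 1 → ℂ) := {w | ‖w 0 • X‖ < 1}
  have hW : W = (fun w : Fin 1 → ℂ => w 0 • X) ⁻¹' Metric.ball 0 1 := by
    ext w; simp [W]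
  have hcont : Continuous fun w : Fin 1 → ℂ => w 0 • X := by fun_prop
  have hconv : Convex ℝ W := by
    rw [hW]
    have : (fun w : Fin 1 → ℂ => w 0 • X) =
        ((LinearMap.toSpanSingleton ℂ (OpSpace g' g n) X).comp
          (LinearMap.proj (0 : Fin 1))).restrictScalars ℝ := by
      ext w; simp
    rw [this]
    exact (convex_ball 0 1).linear_preimage _
  have hne : (0 : Fin 1 → ℂ) ∈ W := by simp [W]
  have h := (hf.comp n 1 W (fun w => w 0 • X) (hW ▸ Metric.isOpen_ball.preimage hcont)
    ⟨⟨_, hne⟩, hconv.isPreconnected⟩ (fun w hw => hw) (by fun_prop)).1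
  have h2 : DifferentiableOn ℂ (fun z : ℂ => (fun _ : Fin 1 => z)) {z : ℂ | ‖z • X‖ < 1} := by
    fun_prop
  exact h.comp h2 fun z hz => hz

/-- The identity theorem along a complex line through `0`. -/
lemma eqOn_line {E : Type*} [NormedAddCommGroup E] [NormedSpace ℂ E] [CompleteSpace E]
    {X : OpSpace g' g n} {F q : ℂ → E} (hF : DifferentiableOn ℂ F {z : ℂ | ‖z • X‖ < 1})
    (hq : Differentiable ℂ q) {ε : ℝ} (hε : 0 < ε)
    (h : ∀ z : ℂ, ‖z • X‖ < 1 → ‖z • X‖ < ε → F z = q z) {z : ℂ} (hz : ‖z • X‖ < 1) :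
    F z = q z := by
  have hcont : Continuous fun z : ℂ => z • X := by fun_prop
  have hball : ∀ r : ℝ, {z : ℂ | ‖z • X‖ < r} = (fun z : ℂ => z • X) ⁻¹' Metric.ball 0 r := by
    intro r; ext z; simp
  have ho : ∀ r : ℝ, IsOpen {z : ℂ | ‖z • X‖ < r} := fun r => by
    rw [hball]; exact Metric.isOpen_ball.preimage hcont
  have hconv : Convex ℝ {z : ℂ | ‖z • X‖ < 1} := by
    rw [hball]
    have : (fun z : ℂ => z • X) =
        (LinearMap.toSpanSingleton ℂ (OpSpace g' g n) X).restrictScalars ℝ := by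
      ext w; simp
    rw [this]
    exact (convex_ball 0 1).linear_preimage _
  have h0 : ∀ {r : ℝ}, 0 < r → (0 : ℂ) ∈ {z : ℂ | ‖z • X‖ < r} := fun hr => by simpa using hr
  refine AnalyticOnNhd.eqOn_of_preconnected_of_eventuallyEq (hF.analyticOnNhd (ho 1))
    (hq.differentiableOn.analyticOnNhd (ho 1)) hconv.isPreconnected (h0 one_pos) ?_ hz
  filter_upwards [(ho 1).mem_nhds (h0 one_pos), (ho ε).mem_nhds (h0 hε)] with z hz hz'
  exact h z hz hz'

/-- A series representing `f` near `0` also represents `f` along the whole part of a complex line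
inside the ball, if the line consists of nilpotent points. -/
lemma IsNCAnalytic.eq_on_nilpotent_line {f : NCFun g' g d' d} (hf : IsNCAnalytic f)
    {a : FreeMonoid (Fin g' × Fin g) → Matrix (Fin d') (Fin d) ℂ} {ε : ℝ} (hε : 0 < ε)
    (ha : HasSeries f a ε)
    {N : ℕ} {X : OpSpace g' g n} (hX : WordsVanish N X) {z : ℂ} (hz : ‖z • X‖ < 1) :
    f n (z • X) = ∑ k ∈ Finset.range N, z ^ k • homogPart a k X := by
  refine eqOn_line (F := fun z => f n (z • X))
    (q := fun z => ∑ k ∈ Finset.range N, z ^ k • homogPart a k X)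
    (hf.differentiableOn_line X) (by fun_prop) hε (fun z hz1 hz2 => ?_) hz
  refine tendsto_nhds_unique (ha n (z • X) hz1 hz2) (tendsto_const_nhds.congr' ?_)
  filter_upwards [Filter.eventually_ge_atTop N] with K hK
  simp only [homogPart_smul]
  refine Finset.sum_subset (Finset.range_mono hK) fun k _ hk => ?_
  rw [hX.homogPart_eq_zero a (by simpa using hk), smul_zero]

lemma IsNCAnalytic.tendsto_radial {f : NCFun g' g d' d} (hf : IsNCAnalytic f)
    {a : FreeMonoid (Fin g' × Fin g) → Matrix (Fin d') (Fin d) ℂ} {ε : ℝ} (hε : 0 < ε)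
    (ha : HasSeries f a ε)
    {N : ℕ} {X : OpSpace g' g n} (hX : WordsVanish N X) (hX1 : ‖X‖ ≤ 1) :
    (∀ᶠ r : ℝ in nhdsWithin 1 (Set.Iio 1), (r : ℂ) • X ∈ openBall g' g n) ∧
    Filter.Tendsto (fun r : ℝ => f n ((r : ℂ) • X)) (nhdsWithin 1 (Set.Iio 1))
      (nhds (partialSum a N X)) := by
  have hev : ∀ᶠ r : ℝ in nhdsWithin 1 (Set.Iio 1), (r : ℂ) • X ∈ openBall g' g n := by
    filter_upwards [Ioo_mem_nhdsLT (zero_lt_one (α := ℝ))] with r hr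
    have : ‖(r : ℂ) • X‖ = r * ‖X‖ := by
      rw [norm_smul, Complex.norm_real, Real.norm_of_nonneg hr.1.le]
    change ‖(r : ℂ) • X‖ < 1
    rw [this]
    nlinarith [hr.1, hr.2, norm_nonneg X]
  refine ⟨hev, ?_⟩
  have hc : Continuous fun r : ℝ => ∑ k ∈ Finset.range N, (r : ℂ) ^ k • homogPart a k X := by
    fun_prop
  have h1 := (hc.tendsto 1).mono_left (nhdsWithin_le_nhds (s := Set.Iio 1))
  simp only [Complex.ofReal_one, one_pow, one_smul] at h1
  refine h1.congr' ?_
  filter_upwards [hev] with r hr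
  exact (hf.eq_on_nilpotent_line hε ha hX hr).symm

lemma IsNCAnalytic.contractiveSeries {f : NCFun g' g d' d} (hf : IsNCAnalytic f)
    (hc : IsContractionValued f)
    {a : FreeMonoid (Fin g' × Fin g) → Matrix (Fin d') (Fin d) ℂ} {ε : ℝ} (hε : 0 < ε)
    (ha : HasSeries f a ε) : ContractiveSeries a := by
  intro n N X hX hX1
  obtain ⟨hev, ht⟩ := hf.tendsto_radial hε ha hX hX1
  exact le_of_tendsto ht.norm (hev.mono fun r hr => hc n _ hr)

/-- At nilpotent boundary points radial limits exist, so the boundary condition applies. -/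
lemma IsNCBallMap.norm_partialSum {f : NCFun g' g d' d} (hf : IsNCBallMap f)
    {a : FreeMonoid (Fin g' × Fin g) → Matrix (Fin d') (Fin d) ℂ} {ε : ℝ} (hε : 0 < ε)
    (ha : HasSeries f a ε)
    {N : ℕ} {X : OpSpace g' g n} (hX : WordsVanish N X) (hX1 : ‖X‖ = 1) :
    ‖partialSum a N X‖ = 1 := by
  refine hf.boundary n X hX1 0 _ ?_
  simpa using (hf.analytic.tendsto_radial hε ha hX hX1.le).2

lemma coeff_one_eq_zero {f : NCFun g' g d' d} (h0 : FixesZero f)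
    {a : FreeMonoid (Fin g' × Fin g) → Matrix (Fin d') (Fin d) ℂ} {ε : ℝ} (hε : 0 < ε)
    (ha : HasSeries f a ε) : a 1 = 0 := by
  have h1 := ha 1 0 (by simp [openBall]) (by simpa using hε)
  rw [h0 1] at h1
  have h2 : homogPart a 0 (0 : OpSpace g' g 1) = 0 := by
    refine tendsto_nhds_unique (tendsto_const_nhds.congr' ?_) h1
    filter_upwards [Filter.eventually_gt_atTop 0] with K hK
    rw [Finset.sum_eq_single_of_mem 0 (by simpa using hK)
      fun k _ hk => homogPart_zero_arg a hk]
  rw [homogPart_degree_zero] at h2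
  ext i j
  simpa using congrFun₂ h2 (i, 0) (j, 0)

/-! ### The Bessel inequality for contractive series -/

lemma norm_toEuclideanLin_le {m k : Type*} [Fintype m] [Fintype k] [DecidableEq k]
    (A : Matrix m k ℂ) (x : EuclideanSpace ℂ k) : ‖toEuclideanLin A x‖ ≤ ‖A‖ * ‖x‖ :=
  l2_opNorm_mulVec A x

/-- The matrix of a partial injection between basis vectors is a contraction. -/
lemma norm_partialInjection_le {R C : Type*} [Fintype R] [Fintype C] [DecidableEq C]
    (P : R → C → Prop) [∀ r c, Decidable (P r c)]
    (h₁ : ∀ r c c', P r c → P r c' → c = c') (h₂ : ∀ r r' c, P r c → P r' c → r = r') :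
    ‖(Matrix.of fun r c => if P r c then (1 : ℂ) else 0)‖ ≤ 1 := by
  set M : Matrix R C ℂ := Matrix.of fun r c => if P r c then (1 : ℂ) else 0 with hM
  have hd : Mᴴ * M = diagonal fun c => ((Finset.univ.filter fun r => P r c).card : ℂ) := by
    ext c c'
    rw [Matrix.mul_apply]
    by_cases hc : c = c'
    · subst hc
      simp [hM, ← ite_and]
    · rw [diagonal_apply_ne _ hc]
      refine Finset.sum_eq_zero fun r _ => ?_
      by_cases h : P r c
      · have : ¬ P r c' := fun h' => hc (h₁ r c c' h h')
        simp [hM, this]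
      · simp [hM, h]
  have h := l2_opNorm_conjTranspose_mul_self M
  rw [hd, l2_opNorm_diagonal] at h
  have h1 : ‖fun c => ((Finset.univ.filter fun r => P r c).card : ℂ)‖ ≤ 1 := by
    refine (pi_norm_le_iff_of_nonneg zero_le_one).2 fun c => ?_
    rw [Complex.norm_natCast]
    exact_mod_cast Finset.card_le_one.2 fun r hr r' hr' =>
      h₂ r r' c (by simpa using hr) (by simpa using hr')
  nlinarith [norm_nonneg M]

/-- Compression of the creation operators of the Fock space to a finite set `S` of words: the
letter `x` sends the basis vector of the word `l` to that of `x :: l`, or to `0` if `x :: l` is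
not in `S`. The words of `S` are enumerated by `Finset.equivFin`. -/
def treeShift (S : Finset (List (Fin g' × Fin g))) : OpSpace g' g S.card :=
  Matrix.of fun r c =>
    if (S.equivFin.symm r.2 : List (Fin g' × Fin g)) = (r.1, c.1) :: S.equivFin.symm c.2
    then 1 else 0

/-- The compressed creation operators form a block matrix of norm at most `1` as soon as no basis
vector `e_j ⊗ e_l` has two different images. -/
lemma norm_treeShift_le (S : Finset (List (Fin g' × Fin g)))
    (hS : ∀ i i' j l, (i, j) :: l ∈ S → (i', j) :: l ∈ S → i = i') : ‖treeShift S‖ ≤ 1 := by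
  refine norm_partialInjection_le _ ?_ ?_
  · rintro ⟨i, t⟩ ⟨j, s⟩ ⟨j', s'⟩ h h'
    have := h.symm.trans h'
    simp only [List.cons.injEq, Prod.mk.injEq, true_and] at this
    rw [this.1, S.equivFin.symm.injective (Subtype.ext this.2)]
  · rintro ⟨i, t⟩ ⟨i', t'⟩ ⟨j, s⟩ h h'
    have hi : i = i' := hS i i' j (S.equivFin.symm s) (h ▸ (S.equivFin.symm t).2)
      (h' ▸ (S.equivFin.symm t').2)
    subst hi
    exact Prod.ext rfl (S.equivFin.symm.injective (Subtype.ext (h.trans h'.symm)))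

lemma wordEval_treeShift (S : Finset (List (Fin g' × Fin g)))
    (hS : ∀ x l, x :: l ∈ S → l ∈ S) (v : List (Fin g' × Fin g)) (t s : Fin S.card) :
    wordEval (treeShift S) (FreeMonoid.ofList v) t s =
      if (S.equivFin.symm t : List (Fin g' × Fin g)) = v ++ S.equivFin.symm s
      then 1 else 0 := by
  rw [wordEval_ofList]
  induction v generalizing t with
  | nil =>
    simp only [List.map_nil, List.prod_nil, List.nil_append, Matrix.one_apply]
    congr 1
    rw [← Subtype.ext_iff, S.equivFin.symm.injective.eq_iff]
  | cons x v ih =>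
    rw [List.map_cons, List.prod_cons, Matrix.mul_apply]
    simp only [ih]
    by_cases h : (S.equivFin.symm t : List (Fin g' × Fin g)) = (x :: v) ++ S.equivFin.symm s
    · have hmem : v ++ S.equivFin.symm s ∈ S := by
        refine hS x _ ?_
        rw [← List.cons_append, ← h]
        exact (S.equivFin.symm t).2
      rw [if_pos h, Finset.sum_eq_single (S.equivFin ⟨_, hmem⟩)]
      · rw [List.cons_append] at h
        simp [block, treeShift, h]
      · intro r _ hr
        rw [if_neg, mul_zero]
        intro h'
        exact hr (by rw [← S.equivFin.symm_apply_eq]; exact Subtype.ext h')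
      · simp
    · rw [if_neg h]
      refine Finset.sum_eq_zero fun r _ => ?_
      by_cases h' : (S.equivFin.symm r : List (Fin g' × Fin g)) = v ++ S.equivFin.symm s
      · rw [List.cons_append, ← h'] at h
        simp [block, treeShift, h]
      · rw [if_neg h', mul_zero]

lemma exists_wordsVanish_treeShift (S : Finset (List (Fin g' × Fin g)))
    (hS : ∀ x l, x :: l ∈ S → l ∈ S) :
    ∃ N, WordsVanish N (treeShift S) ∧ ∀ l ∈ S, l.length < N := by
  refine ⟨S.sup List.length + 1, fun l hl => ?_, fun l hl =>
    Nat.lt_succ_of_le (Finset.le_sup (f := List.length) hl)⟩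
  ext t s
  rw [wordEval_treeShift S hS, if_neg, Matrix.zero_apply]
  intro h
  have h1 := Finset.le_sup (f := List.length) (S.equivFin.symm t).2
  rw [h, List.length_append] at h1
  omega

lemma partialSum_apply_of_wordEval (a : FreeMonoid (Fin g' × Fin g) → Matrix (Fin d') (Fin d) ℂ)
    {N : ℕ} {X : OpSpace g' g n} {t s : Fin n} {l₀ : List (Fin g' × Fin g)} (hl : l₀.length < N)
    (h : ∀ l, wordEval X (FreeMonoid.ofList l) t s = if l = l₀ then 1 else 0)
    (i : Fin d') (j : Fin d) :
    partialSum a N X (i, t) (j, s) = a (FreeMonoid.ofList l₀) i j := by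
  rw [partialSum, Matrix.sum_apply, Finset.sum_eq_single_of_mem l₀.length (by simpa using hl)]
  · rw [homogPart_apply, Finset.sum_eq_single l₀.get]
    · simp [h]
    · intro v _ hv
      rw [h, if_neg, mul_zero]
      rintro h'
      apply hv
      apply List.ofFn_injective
      rw [h', List.ofFn_get]
    · simp
  · intro k _ hk
    rw [homogPart_apply]
    refine Finset.sum_eq_zero fun v _ => ?_
    rw [h, if_neg, mul_zero]
    rintro rfl
    simp at hk

/-- Bessel's inequality: the series is applied to `p ⊗ e_∅` at the compressed creation
operators, and its coefficients appear as the components of the value. -/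
lemma ContractiveSeries.bessel {a : FreeMonoid (Fin g' × Fin g) → Matrix (Fin d') (Fin d) ℂ}
    (ha : ContractiveSeries a) (S : Finset (List (Fin g' × Fin g))) (hnil : [] ∈ S)
    (hS : ∀ x l, x :: l ∈ S → l ∈ S)
    (hS' : ∀ i i' j l, (i, j) :: l ∈ S → (i', j) :: l ∈ S → i = i')
    (p : EuclideanSpace ℂ (Fin d)) :
    ∑ l ∈ S, ‖toEuclideanLin (a (FreeMonoid.ofList l)) p‖ ^ 2 ≤ ‖p‖ ^ 2 := by
  obtain ⟨N, hN, hlen⟩ := exists_wordsVanish_treeShift S hS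
  set s₀ : Fin S.card := S.equivFin ⟨[], hnil⟩ with hs₀
  have hP := ha S.card N (treeShift S) hN (norm_treeShift_le S hS')
  set P := partialSum a N (treeShift S) with hPdef
  have hentry : ∀ i j t, P (i, t) (j, s₀) = a (FreeMonoid.ofList (S.equivFin.symm t)) i j := by
    intro i j t
    refine partialSum_apply_of_wordEval a (hlen _ (S.equivFin.symm t).2) (fun l => ?_) i j
    rw [wordEval_treeShift S hS]
    simp [hs₀, eq_comm]
  let u : EuclideanSpace ℂ (Fin d × Fin S.card) :=
    WithLp.toLp 2 fun c => if c.2 = s₀ then p c.1 else 0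
  have hu : ‖u‖ ^ 2 = ‖p‖ ^ 2 := by
    rw [EuclideanSpace.norm_sq_eq, EuclideanSpace.norm_sq_eq, Fintype.sum_prod_type]
    refine Finset.sum_congr rfl fun j _ => ?_
    rw [Finset.sum_eq_single s₀] <;> simp +contextual [u]
  have hPu : ∀ i t, toEuclideanLin P u (i, t) =
      toEuclideanLin (a (FreeMonoid.ofList (S.equivFin.symm t))) p i := by
    intro i t
    simp only [toLpLin_apply, Matrix.mulVec, dotProduct, Fintype.sum_prod_type]
    refine Finset.sum_congr rfl fun j _ => ?_
    rw [Finset.sum_eq_single s₀] <;> simp +contextual [u, hentry]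
  have h1 : ‖toEuclideanLin P u‖ ^ 2 =
      ∑ l ∈ S, ‖toEuclideanLin (a (FreeMonoid.ofList l)) p‖ ^ 2 := by
    rw [EuclideanSpace.norm_sq_eq, Fintype.sum_prod_type_right, ← Finset.sum_coe_sort S,
      ← S.equivFin.symm.sum_comp]
    refine Finset.sum_congr rfl fun t _ => ?_
    rw [EuclideanSpace.norm_sq_eq]
    exact Finset.sum_congr rfl fun i _ => by rw [hPu]
  rw [← h1, ← hu]
  have h2 := norm_toEuclideanLin_le P u
  gcongr
  nlinarith [norm_nonneg u]

/-- A series which is isometric at `p` on the letters of the column `j₀` has no other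
coefficient that is nonzero at `p`. -/
lemma ContractiveSeries.coeff_apply_eq_zero
    {a : FreeMonoid (Fin g' × Fin g) → Matrix (Fin d') (Fin d) ℂ}
    (ha : ContractiveSeries a) {p : EuclideanSpace ℂ (Fin d)} (hp : ‖p‖ = 1) {j₀ : Fin g}
    (h₀ : ∀ i, ‖toEuclideanLin (a (FreeMonoid.ofList [(i, j₀)])) p‖ = 1)
    {w : List (Fin g' × Fin g)} (hw : w ≠ []) (hw' : ∀ i, w ≠ [(i, j₀)]) :
    toEuclideanLin (a (FreeMonoid.ofList w)) p = 0 := by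
  classical
  obtain ⟨u, ⟨i', j'⟩, rfl⟩ := List.eq_nil_or_concat' w |>.resolve_left hw
  -- `[(i₀, j₀)]` must not compete with the last letter of `w`, which decides `i₀` if it lies in
  -- the column `j₀`.
  obtain ⟨i₀, hi₀⟩ : ∃ i₀, j' = j₀ → i₀ = i' := ⟨i', fun _ => rfl⟩
  set w := u ++ [(i', j')]
  let S : Finset (List (Fin g' × Fin g)) := insert [(i₀, j₀)] w.tails.toFinset
  have hmem : ∀ l, l ∈ S ↔ l = [(i₀, j₀)] ∨ l <:+ w := by intro l; simp [S]
  have hone : ∀ x, [x] <:+ w → x = (i', j') := by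
    intro x hx
    have h2 : [(i', j')] <:+ w := List.suffix_append _ _
    simpa using (List.suffix_of_suffix_length_le hx h2 le_rfl).eq_of_length rfl
  have hb := ha.bessel S ((hmem _).2 (.inr (List.nil_suffix)))
    (fun x l h => by
      rw [hmem] at h ⊢
      rcases h with h | h
      · simp only [List.cons.injEq] at h
        exact .inr (h.2 ▸ List.nil_suffix)
      · exact .inr ((List.suffix_cons x l).trans h))
    (fun i i'' j l h h' => by
      rw [hmem] at h h'
      rcases h with h | h <;> rcases h' with h' | h'
      · simp_all
      · simp only [List.cons.injEq, Prod.mk.injEq] at h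
        obtain ⟨⟨rfl, rfl⟩, rfl⟩ := h
        have := hone _ h'
        simp only [Prod.mk.injEq] at this
        rw [hi₀ this.2.symm, this.1]
      · simp only [List.cons.injEq, Prod.mk.injEq] at h'
        obtain ⟨⟨rfl, rfl⟩, rfl⟩ := h'
        have := hone _ h
        simp only [Prod.mk.injEq] at this
        rw [hi₀ this.2.symm, this.1]
      · have := (List.suffix_of_suffix_length_le h h' (by simp)).eq_of_length (by simp)
        simpa using this) p
  -- The single letter already exhausts the bound `‖p‖ ^ 2 = 1`, so nothing is left for `w`.
  have hsub : ({[(i₀, j₀)], w} : Finset _) ⊆ S := by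
    intro l hl
    rw [Finset.mem_insert, Finset.mem_singleton] at hl
    exact (hmem l).2 (hl.imp id fun (h : l = w) => h ▸ List.suffix_rfl)
  have hle := (Finset.sum_le_sum_of_subset_of_nonneg hsub
    fun l _ _ => sq_nonneg ‖toEuclideanLin (a (FreeMonoid.ofList l)) p‖).trans hb
  rw [Finset.sum_pair (hw' i₀).symm, h₀, hp] at hle
  rw [← norm_eq_zero]
  nlinarith [norm_nonneg (toEuclideanLin (a (FreeMonoid.ofList w)) p)]

lemma ContractiveSeries.norm_coeff_apply_le
    {a : FreeMonoid (Fin g' × Fin g) → Matrix (Fin d') (Fin d) ℂ}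
    (ha : ContractiveSeries a) (x : Fin g' × Fin g) (p : EuclideanSpace ℂ (Fin d)) :
    ‖toEuclideanLin (a (FreeMonoid.ofList [x])) p‖ ≤ ‖p‖ := by
  classical
  have hb := ha.bessel {[], [x]} (by simp) (by simp) 
    (by rintro i i' j l h h'; simp_all [Prod.ext_iff]) p
  rw [Finset.sum_pair (by simp)] at hb
  refine le_of_sq_le_sq ?_ (norm_nonneg p)
  nlinarith [sq_nonneg ‖toEuclideanLin (a (FreeMonoid.ofList [])) p‖]

/-! ### The adjoint series -/

/-- The coefficients of `X ↦ f(X^*)^*`: words are reversed and letters transposed. -/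
def adjointSeries (a : FreeMonoid (Fin g' × Fin g) → Matrix (Fin d') (Fin d) ℂ) :
    FreeMonoid (Fin g × Fin g') → Matrix (Fin d) (Fin d') ℂ :=
  fun w => (a (FreeMonoid.ofList ((FreeMonoid.toList w).reverse.map Prod.swap)))ᴴ

lemma wordEval_conjTranspose (X : OpSpace g g' n) (l : List (Fin g × Fin g')) :
    (wordEval X (FreeMonoid.ofList l))ᴴ =
      wordEval Xᴴ (FreeMonoid.ofList (l.reverse.map Prod.swap)) := by
  rw [wordEval_ofList, wordEval_ofList, Matrix.conjTranspose_list_prod, List.map_map, List.map_map,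
    ← List.map_reverse]
  rfl

lemma homogPart_adjointSeries (a : FreeMonoid (Fin g' × Fin g) → Matrix (Fin d') (Fin d) ℂ)
    (k : ℕ) (X : OpSpace g g' n) :
    homogPart (adjointSeries a) k X = (homogPart a k Xᴴ)ᴴ := by
  rw [homogPart, homogPart, Matrix.conjTranspose_sum]
  let σ : (Fin k → Fin g × Fin g') ≃ (Fin k → Fin g' × Fin g) :=
    Equiv.arrowCongr Fin.revPerm (Equiv.prodComm _ _)
  have hσ : ∀ v, List.ofFn (σ v) = (List.ofFn v).reverse.map Prod.swap := by
    intro v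
    refine List.ext_getElem (by simp) fun m h₁ h₂ => ?_
    rw [List.getElem_map, List.getElem_reverse, List.getElem_ofFn, List.getElem_ofFn]
    simp only [σ, Equiv.arrowCongr_apply, Function.comp_apply, Equiv.prodComm_apply]
    congr 2
    ext
    simp [Fin.rev]
    omega
  refine (Fintype.sum_equiv σ _ _ fun v => ?_)
  rw [Matrix.conjTranspose_kronecker, hσ, ← wordEval_conjTranspose, conjTranspose_conjTranspose]
  rfl

lemma ContractiveSeries.adjoint {a : FreeMonoid (Fin g' × Fin g) → Matrix (Fin d') (Fin d) ℂ}
    (ha : ContractiveSeries a) : ContractiveSeries (adjointSeries a) := by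
  intro n N X hX hX1
  have h : partialSum (adjointSeries a) N X = (partialSum a N Xᴴ)ᴴ := by
    simp only [partialSum, homogPart_adjointSeries, Matrix.conjTranspose_sum]
  rw [h, l2_opNorm_conjTranspose]
  refine ha n N Xᴴ (fun l hl => ?_) (by rwa [l2_opNorm_conjTranspose])
  have := wordEval_conjTranspose X (l.reverse.map Prod.swap)
  rw [hX _ (by simpa using hl)] at this
  simpa using this.symm

/-! ### The linear part -/

lemma exists_norm_toEuclideanLin_eq {m k : Type*} [Fintype m] [Fintype k] [DecidableEq k]
    (A : Matrix m k ℂ) : ∃ x : EuclideanSpace ℂ k, ‖x‖ ≤ 1 ∧ ‖toEuclideanLin A x‖ = ‖A‖ := by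
  let T := toEuclideanLin.trans LinearMap.toContinuousLinearMap A
  obtain ⟨x, hx, hx'⟩ := (isCompact_closedBall (0 : EuclideanSpace ℂ k) 1).exists_sSup_image_eq
    ⟨0, by simp⟩ (f := fun x => ‖T x‖) (by fun_prop)
  rw [T.sSup_unitClosedBall_eq_norm] at hx'
  exact ⟨x, by simpa using hx, hx'.symm⟩

lemma sum_sum_norm_sub_sq {ι E : Type*} [Fintype ι] [NormedAddCommGroup E]
    [InnerProductSpace ℂ E] (y : ι → E) :
    ∑ j, ∑ k, ‖y j - y k‖ ^ 2 =
      2 * Fintype.card ι * ∑ j, ‖y j‖ ^ 2 - 2 * ‖∑ j, y j‖ ^ 2 := by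
  have h : ‖∑ j, y j‖ ^ 2 = ∑ j, ∑ k, RCLike.re (inner ℂ (y j) (y k)) := by
    rw [← inner_self_eq_norm_sq (𝕜 := ℂ), sum_inner, map_sum]
    exact Finset.sum_congr rfl fun j _ => by rw [inner_sum, map_sum]
  simp only [norm_sub_sq (𝕜 := ℂ), Finset.sum_add_distrib, Finset.sum_sub_distrib, h,
    ← Finset.mul_sum, Finset.sum_const, Finset.card_univ, nsmul_eq_mul]
  ring

/-- The equality case of `∑ i, ‖∑ j, y i j‖ ^ 2 ≤ g * ∑ i, ∑ j, ‖y i j‖ ^ 2 ≤ g * g'`. -/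
lemma eq_of_card_mul_card_le_sum {E : Type*} [NormedAddCommGroup E]
    [InnerProductSpace ℂ E] {y : Fin g' → Fin g → E} {x : Fin g → ℝ} (hg : 0 < g)
    (hy : ∀ i j, ‖y i j‖ ≤ x j) (hx : ∑ j, x j ^ 2 ≤ 1)
    (hsum : (g : ℝ) * g' ≤ ∑ i, ‖∑ j, y i j‖ ^ 2) :
    (∀ i j, ‖y i j‖ = x j) ∧ ∀ i j k, y i j = y i k := by
  have hA : ∀ i j, 0 ≤ x j ^ 2 - ‖y i j‖ ^ 2 := fun i j =>
    sub_nonneg.2 (pow_le_pow_left₀ (norm_nonneg _) (hy i j) 2)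
  have hB : ∀ i, 0 ≤ ∑ j, ∑ k, ‖y i j - y i k‖ ^ 2 := fun i => by positivity
  have hle : ∑ i, (2 * g * ∑ j, (x j ^ 2 - ‖y i j‖ ^ 2) + ∑ j, ∑ k, ‖y i j - y i k‖ ^ 2) ≤ 0 := by
    have : ∀ i, 2 * g * ∑ j, (x j ^ 2 - ‖y i j‖ ^ 2) + ∑ j, ∑ k, ‖y i j - y i k‖ ^ 2 =
        2 * g * ∑ j, x j ^ 2 - 2 * ‖∑ j, y i j‖ ^ 2 := by
      intro i
      rw [sum_sum_norm_sub_sq, Fintype.card_fin, Finset.sum_sub_distrib]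
      ring
    rw [Finset.sum_congr rfl fun i _ => this i]
    simp only [Finset.sum_sub_distrib, ← Finset.mul_sum, Finset.sum_const, Finset.card_univ,
      Fintype.card_fin, nsmul_eq_mul]
    nlinarith [mul_nonneg (Nat.cast_nonneg (α := ℝ) g) (Nat.cast_nonneg (α := ℝ) g')]
  have hC : ∀ i, 0 ≤ 2 * (g : ℝ) * ∑ j, (x j ^ 2 - ‖y i j‖ ^ 2) := fun i =>
    mul_nonneg (by positivity) (Finset.sum_nonneg fun j _ => hA i j)
  have hz : ∀ i, 2 * (g : ℝ) * ∑ j, (x j ^ 2 - ‖y i j‖ ^ 2) + ∑ j, ∑ k, ‖y i j - y i k‖ ^ 2 = 0 :=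
    fun i => (Finset.sum_eq_zero_iff_of_nonneg fun i _ => add_nonneg (hC i) (hB i)).1
      (le_antisymm hle (Finset.sum_nonneg fun i _ => add_nonneg (hC i) (hB i))) i
      (Finset.mem_univ i)
  refine ⟨fun i j => ?_, fun i j k => ?_⟩
  · have h1 : 2 * (g : ℝ) * ∑ j, (x j ^ 2 - ‖y i j‖ ^ 2) = 0 := by
      linarith [hz i, hC i, hB i]
    have h2 : ∑ j, (x j ^ 2 - ‖y i j‖ ^ 2) = 0 :=
      (mul_eq_zero.1 h1).resolve_left (by positivity)
    have h3 := (Finset.sum_eq_zero_iff_of_nonneg fun j _ => hA i j).1 h2 j (Finset.mem_univ j)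
    have h4 := (norm_nonneg _).trans (hy i j)
    exact (sq_eq_sq₀ (norm_nonneg _) h4).1 (by linarith)
  · have h1 : ∑ j, ∑ k, ‖y i j - y i k‖ ^ 2 = 0 := by linarith [hz i, hC i, hB i]
    have h2 := (Finset.sum_eq_zero_iff_of_nonneg fun j _ => by positivity).1 h1 j
      (Finset.mem_univ j)
    have h3 := (Finset.sum_eq_zero_iff_of_nonneg fun j _ => by positivity).1 h2 k
      (Finset.mem_univ k)
    exact sub_eq_zero.1 (norm_eq_zero.1 (pow_eq_zero_iff two_ne_zero |>.1 h3))

/-- The linear part of an NC ball map is isometric at points where all products of two letters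
vanish. -/
lemma IsNCBallMap.norm_homogPart_one {f : NCFun g' g d' d} (hf : IsNCBallMap f)
    {a : FreeMonoid (Fin g' × Fin g) → Matrix (Fin d') (Fin d) ℂ} {ε : ℝ} (hε : 0 < ε)
    (ha : HasSeries f a ε) (h1 : a 1 = 0) {X : OpSpace g' g n} (hX : WordsVanish 2 X) :
    ‖homogPart a 1 X‖ = ‖X‖ := by
  rcases eq_or_ne X 0 with rfl | hX0
  · rw [homogPart_zero_arg a one_ne_zero, norm_zero, norm_zero]
  have hne : ‖X‖ ≠ 0 := norm_ne_zero_iff.2 hX0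
  have hV : WordsVanish 2 ((‖X‖⁻¹ : ℂ) • X) := fun l hl => by
    rw [wordEval_smul, hX l hl, smul_zero]
  have h := hf.norm_partialSum hε ha hV (by
    rw [norm_smul, norm_inv, Complex.norm_real, norm_norm, inv_mul_cancel₀ hne])
  rw [partialSum, Finset.sum_range_succ, Finset.sum_range_one, homogPart_degree_zero, h1,
    Matrix.zero_kronecker, zero_add, homogPart_smul, pow_one, norm_smul, norm_inv,
    Complex.norm_real, norm_norm] at h
  field_simp at h
  exact h

/-- The rank one block matrix with letters `x_{ij} = e_{g + i} e_j^*`. -/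
def rankOnePoint (g' g : ℕ) : OpSpace g' g (g + g') :=
  Matrix.of fun r c => if r.2 = Fin.natAdd g r.1 ∧ c.2 = Fin.castAdd g' c.1 then 1 else 0

lemma wordsVanish_rankOnePoint : WordsVanish 2 (rankOnePoint g' g) := by
  intro l hl
  obtain ⟨x, y, l, rfl⟩ : ∃ x y l', l = x :: y :: l' := by
    match l, hl with
    | x :: y :: l, _ => exact ⟨x, y, l, rfl⟩
  have h : block (rankOnePoint g' g) x * block (rankOnePoint g' g) y = 0 := by
    ext s t
    rw [Matrix.mul_apply, Matrix.zero_apply]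
    refine Finset.sum_eq_zero fun r _ => ?_
    simp only [block, rankOnePoint, Matrix.of_apply, mul_ite, mul_one, mul_zero]
    rw [← ite_and, if_neg]
    rintro ⟨⟨hr, -⟩, -, hr'⟩
    rw [hr] at hr'
    have := congrArg Fin.val hr'
    simp at this
    omega
  rw [wordEval_ofList, List.map_cons, List.map_cons, List.prod_cons, List.prod_cons, ← mul_assoc,
    h, zero_mul]

/-- In fact equality holds. The bound is obtained from the vector `∑ j, e_j ⊗ e_j`. -/
lemma card_mul_card_le_norm_rankOnePoint_sq (hg : 0 < g) :
    (g : ℝ) * g' ≤ ‖rankOnePoint g' g‖ ^ 2 := by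
  let v : EuclideanSpace ℂ (Fin g × Fin (g + g')) :=
    WithLp.toLp 2 fun c => if c.2 = Fin.castAdd g' c.1 then 1 else 0
  have hv : ‖v‖ ^ 2 = g := by
    rw [EuclideanSpace.norm_sq_eq, Fintype.sum_prod_type]
    simp [v, apply_ite]
  have hXv : ‖toEuclideanLin (rankOnePoint g' g) v‖ ^ 2 = g' * (g : ℝ) ^ 2 := by
    have : ∀ i t, toEuclideanLin (rankOnePoint g' g) v (i, t) =
        if t = Fin.natAdd g i then (g : ℂ) else 0 := by
      intro i t
      simp only [toLpLin_apply, Matrix.mulVec, dotProduct, Fintype.sum_prod_type, rankOnePoint, v,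
        Matrix.of_apply]
      by_cases h : t = Fin.natAdd g i <;> simp [h]
    rw [EuclideanSpace.norm_sq_eq, Fintype.sum_prod_type]
    simp [this, apply_ite]
  have h := pow_le_pow_left₀ (norm_nonneg _) (norm_toEuclideanLin_le (rankOnePoint g' g) v) 2
  rw [mul_pow, hv, hXv] at h
  have hg0 : (0 : ℝ) < g := by exact_mod_cast hg
  nlinarith

lemma homogPart_one_rankOnePoint_apply
    (a : FreeMonoid (Fin g' × Fin g) → Matrix (Fin d') (Fin d) ℂ)
    (x : EuclideanSpace ℂ (Fin d × Fin (g + g'))) (r : Fin d') (t : Fin (g + g')) :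
    toEuclideanLin (homogPart a 1 (rankOnePoint g' g)) x (r, t) =
      ∑ i, if t = Fin.natAdd g i then
        ∑ j, toEuclideanLin (a (FreeMonoid.ofList [(i, j)]))
          (WithLp.toLp 2 fun c => x (c, Fin.castAdd g' j)) r else 0 := by
  simp only [toLpLin_apply, Matrix.mulVec, dotProduct, homogPart_degree_one_apply,
    Finset.sum_mul]
  rw [Finset.sum_comm, Fintype.sum_prod_type]
  refine Finset.sum_congr rfl fun i _ => ?_
  split_ifs with h
  · refine Finset.sum_congr rfl fun j _ => ?_
    rw [Fintype.sum_prod_type]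
    simp [rankOnePoint, h]
  · simp [rankOnePoint, h]

/-- The norm of the linear part at `rankOnePoint g' g` is attained only at vectors on which all
coefficients of the linear part are isometric in a compatible way. -/
lemma IsNCBallMap.exists_coeff_apply_eq {f : NCFun g' g d' d} (hf : IsNCBallMap f)
    {a : FreeMonoid (Fin g' × Fin g) → Matrix (Fin d') (Fin d) ℂ} {ε : ℝ} (hε : 0 < ε)
    (ha : HasSeries f a ε) (h1 : a 1 = 0) (hg' : 0 < g') (hg : 0 < g) :
    ∃ (p : Fin g → EuclideanSpace ℂ (Fin d)) (q : Fin g' → EuclideanSpace ℂ (Fin d')),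
      (∀ j, ‖p j‖ = 1) ∧ (∀ i, ‖q i‖ = 1) ∧
      ∀ i j, toEuclideanLin (a (FreeMonoid.ofList [(i, j)])) (p j) = q i := by
  have hc := hf.analytic.contractiveSeries hf.contractive hε ha
  obtain ⟨x, hx, hx'⟩ := exists_norm_toEuclideanLin_eq (homogPart a 1 (rankOnePoint g' g))
  rw [hf.norm_homogPart_one hε ha h1 wordsVanish_rankOnePoint] at hx'
  let ξ : Fin g → EuclideanSpace ℂ (Fin d) := fun j =>
    WithLp.toLp 2 fun c => x (c, Fin.castAdd g' j)
  let y : Fin g' → Fin g → EuclideanSpace ℂ (Fin d') := fun i j =>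
    toEuclideanLin (a (FreeMonoid.ofList [(i, j)])) (ξ j)
  have hξ : ∑ j, ‖ξ j‖ ^ 2 ≤ 1 := by
    have : ‖x‖ ^ 2 ≤ 1 := pow_le_one₀ (norm_nonneg _) hx
    rw [EuclideanSpace.norm_sq_eq, Fintype.sum_prod_type_right, Fin.sum_univ_add] at this
    simp only [EuclideanSpace.norm_sq_eq, ξ]
    refine le_trans (le_add_of_nonneg_right ?_) this
    positivity
  have hsum : (g : ℝ) * g' ≤ ∑ i, ‖∑ j, y i j‖ ^ 2 := by
    refine (card_mul_card_le_norm_rankOnePoint_sq hg).trans_eq ?_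
    rw [← hx', EuclideanSpace.norm_sq_eq, Fintype.sum_prod_type_right, Fin.sum_univ_add]
    have hz : ∀ (t : Fin g) (i : Fin g'), Fin.castAdd g' t ≠ Fin.natAdd g i := by
      intro t i h
      have := congrArg Fin.val h
      simp at this
      omega
    simp only [homogPart_one_rankOnePoint_apply, hz, if_false, Finset.sum_const_zero, norm_zero,
      EuclideanSpace.norm_sq_eq, (Fin.natAdd_injective g' g).eq_iff, Finset.sum_ite_eq,
      Finset.mem_univ, if_true]
    simp [y, ξ]
  obtain ⟨hy1, hy2⟩ := eq_of_card_mul_card_le_sum (x := fun j => ‖ξ j‖) hg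
    (fun i j => hc.norm_coeff_apply_le (i, j) (ξ j)) hξ hsum
  replace hy1 : ∀ i j, ‖y i j‖ = ‖ξ j‖ := hy1
  replace hy2 : ∀ i j k, y i j = y i k := hy2
  have hgg : (0 : ℝ) < (g : ℝ) * g' := by positivity
  let j₀ : Fin g := ⟨0, hg⟩
  let i₀ : Fin g' := ⟨0, hg'⟩
  have hyρ : ∀ i j, ‖y i j‖ = ‖ξ j₀‖ := fun i j => by rw [hy2 i j j₀, hy1]
  have hξρ : ∀ j, ‖ξ j‖ = ‖ξ j₀‖ := fun j => by rw [← hyρ i₀ j, hy1]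
  have hρ : ‖ξ j₀‖ ≠ 0 := by
    intro h0
    have : ∀ i j, y i j = 0 := fun i j => norm_eq_zero.1 ((hyρ i j).trans h0)
    simp only [this, Finset.sum_const_zero, norm_zero] at hsum
    norm_num at hsum
    linarith
  -- All `ξ j` and `y i j` have the same nonzero norm, and `y i j` does not depend on `j`:
  -- normalizing them gives `p` and `q`.
  have hnorm : ∀ {m : ℕ} (z : EuclideanSpace ℂ (Fin m)), ‖z‖ = ‖ξ j₀‖ →
      ‖(‖ξ j₀‖⁻¹ : ℂ) • z‖ = 1 := by
    intro m z hz
    rw [norm_smul, norm_inv, Complex.norm_real, norm_norm, hz, inv_mul_cancel₀ hρ]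
  refine ⟨fun j => (‖ξ j₀‖⁻¹ : ℂ) • ξ j, fun i => (‖ξ j₀‖⁻¹ : ℂ) • y i j₀,
    fun j => hnorm _ (hξρ j), fun i => hnorm _ (hyρ i j₀), fun i j => ?_⟩
  rw [map_smul]
  exact congrArg _ (hy2 i j j₀)

lemma inner_toEuclideanLin_conjTranspose {m k : ℕ} (A : Matrix (Fin m) (Fin k) ℂ)
    (x : EuclideanSpace ℂ (Fin k)) (y : EuclideanSpace ℂ (Fin m)) :
    inner ℂ (toEuclideanLin Aᴴ y) x = inner ℂ y (toEuclideanLin A x) := by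
  rw [Matrix.toEuclideanLin_conjTranspose_eq_adjoint, LinearMap.adjoint_inner_left]

/-- If `A` is norm-preserving at `x`, and `Aᴴ` does not increase the norm of `A x`, then `Aᴴ A`
fixes `x`. -/
lemma toEuclideanLin_conjTranspose_apply_eq {m k : ℕ} {A : Matrix (Fin m) (Fin k) ℂ}
    {x : EuclideanSpace ℂ (Fin k)} {y : EuclideanSpace ℂ (Fin m)} (hxy : toEuclideanLin A x = y)
    (hn : ‖y‖ = ‖x‖) (hy : ‖toEuclideanLin Aᴴ y‖ ≤ ‖y‖) : toEuclideanLin Aᴴ y = x := by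
  have h := norm_sub_sq (𝕜 := ℂ) (toEuclideanLin Aᴴ y) x
  rw [inner_toEuclideanLin_conjTranspose, hxy, inner_self_eq_norm_sq] at h
  have h2 : ‖toEuclideanLin Aᴴ y - x‖ ^ 2 ≤ 0 := by
    rw [h, hn]
    rw [hn] at hy
    nlinarith [norm_nonneg (toEuclideanLin Aᴴ y)]
  exact sub_eq_zero.1 (norm_eq_zero.1 (pow_eq_zero_iff two_ne_zero |>.1
    (le_antisymm h2 (sq_nonneg _))))

/-- The coefficients of an NC ball map fixing `0`, in suitable orthonormal systems `p` and `q`: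
every coefficient vanishes on all `p j`, except that the one of `x_{ij}` sends `p j` to `q i`, and
the same holds for the adjoints. -/
lemma IsNCBallMap.exists_orthonormal {f : NCFun g' g d' d} (hf : IsNCBallMap f)
    {a : FreeMonoid (Fin g' × Fin g) → Matrix (Fin d') (Fin d) ℂ} {ε : ℝ} (hε : 0 < ε)
    (ha : HasSeries f a ε) (h1 : a 1 = 0) (hg' : 0 < g') (hg : 0 < g) :
    ∃ (p : Fin g → EuclideanSpace ℂ (Fin d)) (q : Fin g' → EuclideanSpace ℂ (Fin d')),
      Orthonormal ℂ p ∧ Orthonormal ℂ q ∧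
      (∀ i j, toEuclideanLin (a (FreeMonoid.ofList [(i, j)])) (p j) = q i) ∧
      (∀ i j, toEuclideanLin (a (FreeMonoid.ofList [(i, j)]))ᴴ (q i) = p j) ∧
      (∀ j w, (∀ i, w ≠ [(i, j)]) → toEuclideanLin (a (FreeMonoid.ofList w)) (p j) = 0) ∧
      (∀ i w, (∀ j, w ≠ [(i, j)]) → toEuclideanLin (a (FreeMonoid.ofList w))ᴴ (q i) = 0) := by
  have hc := hf.analytic.contractiveSeries hf.contractive hε ha
  obtain ⟨p, q, hp, hq, hpq⟩ := hf.exists_coeff_apply_eq hε ha h1 hg' hg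
  have hqp : ∀ i j, toEuclideanLin (a (FreeMonoid.ofList [(i, j)]))ᴴ (q i) = p j := fun i j =>
    toEuclideanLin_conjTranspose_apply_eq (hpq i j) ((hq i).trans (hp j).symm)
      (hc.adjoint.norm_coeff_apply_le (j, i) (q i))
  have hp0 : ∀ j w, (∀ i, w ≠ [(i, j)]) →
      toEuclideanLin (a (FreeMonoid.ofList w)) (p j) = 0 := by
    intro j w hw
    rcases eq_or_ne w [] with rfl | hw0
    · rw [FreeMonoid.ofList_nil, h1, map_zero, LinearMap.zero_apply]
    · exact hc.coeff_apply_eq_zero (hp j) (fun i => by rw [hpq, hq]) hw0 hw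
  have hq0 : ∀ i w, (∀ j, w ≠ [(i, j)]) →
      toEuclideanLin (a (FreeMonoid.ofList w))ᴴ (q i) = 0 := by
    intro i w hw
    rcases eq_or_ne w [] with rfl | hw0
    · rw [FreeMonoid.ofList_nil, h1, conjTranspose_zero, map_zero, LinearMap.zero_apply]
    · have h := hc.adjoint.coeff_apply_eq_zero (hq i) (j₀ := i)
        (fun j => by
          change ‖toEuclideanLin (a (FreeMonoid.ofList [(i, j)]))ᴴ (q i)‖ = 1
          rw [hqp, hp])
        (w := (w.map Prod.swap).reverse) (by simpa using hw0) (fun j hj => hw j (by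
          have := congrArg (fun l => l.reverse.map Prod.swap) hj
          simpa using this))
      simpa [adjointSeries] using h
  refine ⟨p, q, ⟨hp, fun j k hjk => ?_⟩, ⟨hq, fun i k hik => ?_⟩, hpq, hqp, hp0, hq0⟩
  · change inner ℂ (p j) (p k) = 0
    rw [← hqp ⟨0, hg'⟩ j, inner_toEuclideanLin_conjTranspose, hp0, inner_zero_right]
    simp [hjk]
  · change inner ℂ (q i) (q k) = 0
    rw [← hpq k ⟨0, hg⟩, ← inner_toEuclideanLin_conjTranspose, hq0, inner_zero_left]
    simp [hik.symm]

/-! ### Block diagonal matrices and scalar unitaries -/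

/-- The splitting of `b` indices into the first `m` and the last `b - m`. -/
def blockIndex {m b : ℕ} (h : m ≤ b) : Fin m ⊕ Fin (b - m) ≃ Fin b :=
  finSumFinEquiv.trans (finCongr (Nat.add_sub_of_le h))

lemma splitEquiv_inl {m b : ℕ} (h : m ≤ b) (x : Fin m × Fin n) :
    splitEquiv h n (Sum.inl x) = (blockIndex h (Sum.inl x.1), x.2) := rfl

lemma splitEquiv_inr {m b : ℕ} (h : m ≤ b) (x : Fin (b - m) × Fin n) :
    splitEquiv h n (Sum.inr x) = (blockIndex h (Sum.inr x.1), x.2) := rfl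

/-- The block diagonal matrix `[A 0; 0 C]` of scalar matrices. -/
def scalarBlockDiag (h' : g' ≤ d') (h : g ≤ d) (A : Matrix (Fin g') (Fin g) ℂ)
    (C : Matrix (Fin (d' - g')) (Fin (d - g)) ℂ) : Matrix (Fin d') (Fin d) ℂ :=
  Matrix.reindex (blockIndex h') (blockIndex h) (Matrix.fromBlocks A 0 0 C)

/-- `blockDiag` as a linear map. -/
def blockDiagLin (h' : g' ≤ d') (h : g ≤ d) (n : ℕ) :
    (OpSpace g' g n × OpSpace (d' - g') (d - g) n) →ₗ[ℂ] OpSpace d' d n where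
  toFun P := blockDiag h' h P.1 P.2
  map_add' P Q := by
    ext i j
    obtain ⟨i, rfl⟩ := (splitEquiv h' n).surjective i
    obtain ⟨j, rfl⟩ := (splitEquiv h n).surjective j
    rcases i with i | i <;> rcases j with j | j <;> simp [blockDiag]
  map_smul' z P := by
    ext i j
    obtain ⟨i, rfl⟩ := (splitEquiv h' n).surjective i
    obtain ⟨j, rfl⟩ := (splitEquiv h n).surjective j
    rcases i with i | i <;> rcases j with j | j <;> simp [blockDiag]

/-- The lower right corner of a block matrix. -/
def cornerLin (h' : g' ≤ d') (h : g ≤ d) (n : ℕ) :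
    OpSpace d' d n →ₗ[ℂ] OpSpace (d' - g') (d - g) n where
  toFun Y := Y.submatrix (fun x => splitEquiv h' n (Sum.inr x)) fun x => splitEquiv h n (Sum.inr x)
  map_add' _ _ := rfl
  map_smul' _ _ := rfl

/-- The map `Y ↦ (V ⊗ I) Y (U ⊗ I)`. -/
def amplLin (V : Matrix (Fin d') (Fin d') ℂ) (U : Matrix (Fin d) (Fin d) ℂ) (n : ℕ) :
    OpSpace d' d n →ₗ[ℂ] OpSpace d' d n where
  toFun Y := ampl V n * Y * ampl U n
  map_add' Y Z := by rw [Matrix.mul_add, Matrix.add_mul]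
  map_smul' z Y := by simp

lemma blockDiagLin_apply (h' : g' ≤ d') (h : g ≤ d)
    (P : OpSpace g' g n × OpSpace (d' - g') (d - g) n) :
    blockDiagLin h' h n P = blockDiag h' h P.1 P.2 := rfl

lemma amplLin_apply (V : Matrix (Fin d') (Fin d') ℂ) (U : Matrix (Fin d) (Fin d) ℂ)
    (Y : OpSpace d' d n) : amplLin V U n Y = ampl V n * Y * ampl U n := rfl

lemma blockDiag_submatrix_inl (h' : g' ≤ d') (h : g ≤ d) (X : OpSpace g' g n)
    (Y : OpSpace (d' - g') (d - g) n) :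
    (blockDiag h' h X Y).submatrix (fun x => splitEquiv h' n (Sum.inl x))
      (fun x => splitEquiv h n (Sum.inl x)) = X := by
  ext; simp [blockDiag]

lemma cornerLin_blockDiag (h' : g' ≤ d') (h : g ≤ d) (X : OpSpace g' g n)
    (Y : OpSpace (d' - g') (d - g) n) : cornerLin h' h n (blockDiag h' h X Y) = Y := by
  ext i j
  change blockDiag h' h X Y (splitEquiv h' n (Sum.inr i)) (splitEquiv h n (Sum.inr j)) = Y i j
  simp [blockDiag]

lemma norm_submatrix_le {R C R' C' : Type*} [Fintype R] [Fintype C] [Fintype R'] [Fintype C']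
    [DecidableEq R] [DecidableEq C] [DecidableEq C'] (A : Matrix R C ℂ) {e : R' → R} {f : C' → C}
    (he : Function.Injective e) (hf : Function.Injective f) : ‖A.submatrix e f‖ ≤ ‖A‖ := by
  let E : Matrix R' R ℂ := Matrix.of fun r c => if e r = c then 1 else 0
  let F : Matrix C C' ℂ := Matrix.of fun r c => if r = f c then 1 else 0
  have h : A.submatrix e f = E * A * F := by
    ext i j
    simp [E, F, Matrix.mul_apply]
  have hE : ‖E‖ ≤ 1 := norm_partialInjection_le _ (fun _ _ _ h h' => h.symm.trans h')
    fun _ _ _ h h' => he (h.trans h'.symm)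
  have hF : ‖F‖ ≤ 1 := norm_partialInjection_le _ (fun _ _ _ h h' => hf (h.symm.trans h'))
    fun _ _ _ h h' => h.trans h'.symm
  rw [h]
  calc ‖E * A * F‖ ≤ ‖E * A‖ * ‖F‖ := l2_opNorm_mul _ _
    _ ≤ (‖E‖ * ‖A‖) * ‖F‖ := by gcongr; exact l2_opNorm_mul _ _
    _ ≤ (1 * ‖A‖) * 1 := by gcongr
    _ = ‖A‖ := by ring

lemma norm_le_norm_blockDiag (h' : g' ≤ d') (h : g ≤ d) (X : OpSpace g' g n)
    (Y : OpSpace (d' - g') (d - g) n) : ‖X‖ ≤ ‖blockDiag h' h X Y‖ := by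
  conv_lhs => rw [← blockDiag_submatrix_inl h' h X Y]
  exact norm_submatrix_le _ ((splitEquiv h' n).injective.comp Sum.inl_injective)
    ((splitEquiv h n).injective.comp Sum.inl_injective)

lemma norm_cornerLin_le (h' : g' ≤ d') (h : g ≤ d) (Y : OpSpace d' d n) :
    ‖cornerLin h' h n Y‖ ≤ ‖Y‖ :=
  norm_submatrix_le _ ((splitEquiv h' n).injective.comp Sum.inr_injective)
    ((splitEquiv h n).injective.comp Sum.inr_injective)

lemma norm_blockDiag_le_one (h' : g' ≤ d') (h : g ≤ d) {X : OpSpace g' g n}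
    {Y : OpSpace (d' - g') (d - g) n} (hX : ‖X‖ ≤ 1) (hY : ‖Y‖ ≤ 1) :
    ‖blockDiag h' h X Y‖ ≤ 1 := by
  rw [l2_opNorm_def]
  refine ContinuousLinearMap.opNorm_le_bound _ zero_le_one fun v => ?_
  rw [one_mul]
  change ‖toEuclideanLin (blockDiag h' h X Y) v‖ ≤ ‖v‖
  let v₁ : EuclideanSpace ℂ (Fin g × Fin n) :=
    WithLp.toLp 2 fun x => v (splitEquiv h n (Sum.inl x))
  let v₂ : EuclideanSpace ℂ (Fin (d - g) × Fin n) :=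
    WithLp.toLp 2 fun x => v (splitEquiv h n (Sum.inr x))
  have hv : ‖v‖ ^ 2 = ‖v₁‖ ^ 2 + ‖v₂‖ ^ 2 := by
    simp only [EuclideanSpace.norm_sq_eq]
    rw [← (splitEquiv h n).sum_comp, Fintype.sum_sum_type]
  have e₁ : ∀ x, toEuclideanLin (blockDiag h' h X Y) v (splitEquiv h' n (Sum.inl x)) =
      toEuclideanLin X v₁ x := by
    intro x
    simp only [toLpLin_apply, Matrix.mulVec, dotProduct]
    rw [← (splitEquiv h n).sum_comp, Fintype.sum_sum_type]
    simp [blockDiag, v₁]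
  have e₂ : ∀ x, toEuclideanLin (blockDiag h' h X Y) v (splitEquiv h' n (Sum.inr x)) =
      toEuclideanLin Y v₂ x := by
    intro x
    simp only [toLpLin_apply, Matrix.mulVec, dotProduct]
    rw [← (splitEquiv h n).sum_comp, Fintype.sum_sum_type]
    simp [blockDiag, v₂]
  have hw : ‖toEuclideanLin (blockDiag h' h X Y) v‖ ^ 2 =
      ‖toEuclideanLin X v₁‖ ^ 2 + ‖toEuclideanLin Y v₂‖ ^ 2 := by
    rw [EuclideanSpace.norm_sq_eq, EuclideanSpace.norm_sq_eq, EuclideanSpace.norm_sq_eq,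
      ← (splitEquiv h' n).sum_comp, Fintype.sum_sum_type]
    simp only [e₁, e₂]
  have h₁ : ‖toEuclideanLin X v₁‖ ≤ ‖v₁‖ := (norm_toEuclideanLin_le X v₁).trans
    (mul_le_of_le_one_left (norm_nonneg _) hX)
  have h₂ : ‖toEuclideanLin Y v₂‖ ≤ ‖v₂‖ := (norm_toEuclideanLin_le Y v₂).trans
    (mul_le_of_le_one_left (norm_nonneg _) hY)
  refine le_of_sq_le_sq ?_ (norm_nonneg _)
  rw [hw, hv]
  gcongr

lemma ampl_mul (A B : Matrix (Fin d) (Fin d) ℂ) : ampl A n * ampl B n = ampl (A * B) n := by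
  rw [ampl, ampl, ampl, ← Matrix.mul_kronecker_mul, one_mul]

lemma ampl_one : ampl (1 : Matrix (Fin d) (Fin d) ℂ) n = 1 := Matrix.one_kronecker_one

lemma ampl_conjTranspose (A : Matrix (Fin d) (Fin d) ℂ) : (ampl A n)ᴴ = ampl Aᴴ n := by
  rw [ampl, ampl, Matrix.conjTranspose_kronecker, Matrix.conjTranspose_one]

lemma norm_le_one_of_conjTranspose_mul_self {k : Type*} [Fintype k] [DecidableEq k]
    {A : Matrix k k ℂ} (h : Aᴴ * A = 1) : ‖A‖ ≤ 1 := by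
  have h1 := l2_opNorm_conjTranspose_mul_self A
  rw [h, ← Matrix.diagonal_one, l2_opNorm_diagonal] at h1
  have h2 : ‖fun _ : k => (1 : ℂ)‖ ≤ 1 := (pi_norm_le_iff_of_nonneg zero_le_one).2 (by simp)
  nlinarith [norm_nonneg A]

lemma norm_ampl_le_one {U : Matrix (Fin d) (Fin d) ℂ} (hU : U ∈ Matrix.unitaryGroup (Fin d) ℂ) :
    ‖ampl U n‖ ≤ 1 := by
  refine norm_le_one_of_conjTranspose_mul_self ?_
  rw [ampl_conjTranspose, ampl_mul, ← Matrix.star_eq_conjTranspose,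
    Matrix.mem_unitaryGroup_iff'.1 hU, ampl_one]

lemma norm_amplLin_le {V : Matrix (Fin d') (Fin d') ℂ} {U : Matrix (Fin d) (Fin d) ℂ}
    (hV : V ∈ Matrix.unitaryGroup (Fin d') ℂ) (hU : U ∈ Matrix.unitaryGroup (Fin d) ℂ)
    (Y : OpSpace d' d n) : ‖amplLin V U n Y‖ ≤ ‖Y‖ :=
  calc ‖ampl V n * Y * ampl U n‖ ≤ ‖ampl V n * Y‖ * ‖ampl U n‖ := l2_opNorm_mul _ _
    _ ≤ (‖ampl V n‖ * ‖Y‖) * ‖ampl U n‖ := by gcongr; exact l2_opNorm_mul _ _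
    _ ≤ (1 * ‖Y‖) * 1 := by gcongr <;> exact norm_ampl_le_one ‹_›
    _ = ‖Y‖ := by ring

lemma conjTranspose_mem_unitaryGroup {U : Matrix (Fin d) (Fin d) ℂ}
    (hU : U ∈ Matrix.unitaryGroup (Fin d) ℂ) : Uᴴ ∈ Matrix.unitaryGroup (Fin d) ℂ :=
  Unitary.star_mem hU

/-- `Y ↦ (V ⊗ I)^* Y (U ⊗ I)` and `Y ↦ (V ⊗ I) Y (U ⊗ I)^*` are inverse to each other. -/
lemma amplLin_conjTranspose_amplLin {V : Matrix (Fin d') (Fin d') ℂ}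
    {U : Matrix (Fin d) (Fin d) ℂ} (hV : V ∈ Matrix.unitaryGroup (Fin d') ℂ)
    (hU : U ∈ Matrix.unitaryGroup (Fin d) ℂ) (Y : OpSpace d' d n) :
    amplLin Vᴴ U n (amplLin V Uᴴ n Y) = Y := by
  have h1 : ampl Vᴴ n * ampl V n = 1 := by
    rw [ampl_mul, ← Matrix.star_eq_conjTranspose, Matrix.mem_unitaryGroup_iff'.1 hV, ampl_one]
  have h2 : ampl Uᴴ n * ampl U n = 1 := by
    rw [ampl_mul, ← Matrix.star_eq_conjTranspose, Matrix.mem_unitaryGroup_iff'.1 hU, ampl_one]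
  simp only [amplLin_apply]
  rw [Matrix.mul_assoc, Matrix.mul_assoc, h2, Matrix.mul_one, ← Matrix.mul_assoc, h1,
    Matrix.one_mul]

lemma amplLin_amplLin_conjTranspose {V : Matrix (Fin d') (Fin d') ℂ}
    {U : Matrix (Fin d) (Fin d) ℂ} (hV : V ∈ Matrix.unitaryGroup (Fin d') ℂ)
    (hU : U ∈ Matrix.unitaryGroup (Fin d) ℂ) (Y : OpSpace d' d n) :
    amplLin V Uᴴ n (amplLin Vᴴ U n Y) = Y := by
  simpa using amplLin_conjTranspose_amplLin (conjTranspose_mem_unitaryGroup hV)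
    (conjTranspose_mem_unitaryGroup hU) Y

lemma norm_amplLin {V : Matrix (Fin d') (Fin d') ℂ} {U : Matrix (Fin d) (Fin d) ℂ}
    (hV : V ∈ Matrix.unitaryGroup (Fin d') ℂ) (hU : U ∈ Matrix.unitaryGroup (Fin d) ℂ)
    (Y : OpSpace d' d n) : ‖amplLin V Uᴴ n Y‖ = ‖Y‖ := by
  refine le_antisymm (norm_amplLin_le hV (conjTranspose_mem_unitaryGroup hU) Y) ?_
  conv_lhs => rw [← amplLin_conjTranspose_amplLin hV hU Y]
  exact norm_amplLin_le (conjTranspose_mem_unitaryGroup hV) hU _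

/-! ### Operations on NC power series -/

/-- The coefficients of the NC power series `x`. -/
def letterCoeff (w : FreeMonoid (Fin g' × Fin g)) : Matrix (Fin g') (Fin g) ℂ :=
  Matrix.of fun i j => if FreeMonoid.toList w = [(i, j)] then 1 else 0

lemma letterCoeff_ofList_apply (l : List (Fin g' × Fin g)) (i : Fin g') (j : Fin g) :
    letterCoeff (FreeMonoid.ofList l) i j = if l = [(i, j)] then 1 else 0 := rfl

lemma homogPart_letterCoeff (k : ℕ) (X : OpSpace g' g n) :
    homogPart letterCoeff k X = if k = 1 then X else 0 := by
  split_ifs with hk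
  · subst hk
    ext r c
    rw [homogPart_degree_one_apply, Finset.sum_eq_single (r.1, c.1)]
    · rw [letterCoeff_ofList_apply]
      simp
    · intro x _ hx
      have : [x] ≠ [(r.1, c.1)] := by simpa using hx
      rw [letterCoeff_ofList_apply, if_neg this, zero_mul]
    · simp
  · ext r c
    rw [homogPart_apply]
    refine Finset.sum_eq_zero fun v _ => ?_
    have : List.ofFn v ≠ [(r.1, c.1)] := by
      intro h
      have := congrArg List.length h
      simp at this
      exact hk this
    rw [letterCoeff_ofList_apply, if_neg this, zero_mul]

lemma sum_homogPart_letterCoeff {K : ℕ} (hK : 2 ≤ K) (X : OpSpace g' g n) :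
    ∑ k ∈ Finset.range K, homogPart letterCoeff k X = X := by
  simp only [homogPart_letterCoeff, Finset.sum_ite_eq', Finset.mem_range]
  exact if_pos hK

lemma homogPart_mul_mul (V : Matrix (Fin d') (Fin d') ℂ) (U : Matrix (Fin d) (Fin d) ℂ)
    (a : FreeMonoid (Fin g' × Fin g) → Matrix (Fin d') (Fin d) ℂ) (k : ℕ) (X : OpSpace g' g n) :
    homogPart (fun w => V * a w * U) k X = amplLin V U n (homogPart a k X) := by
  rw [homogPart, homogPart, map_sum]
  refine Finset.sum_congr rfl fun v _ => ?_
  rw [amplLin_apply, ampl, ampl, ← Matrix.mul_kronecker_mul, ← Matrix.mul_kronecker_mul, one_mul,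
    mul_one]

lemma homogPart_scalarBlockDiag (h' : g' ≤ d') (h : g ≤ d)
    (a : FreeMonoid (Fin g' × Fin g) → Matrix (Fin g') (Fin g) ℂ)
    (c : FreeMonoid (Fin g' × Fin g) → Matrix (Fin (d' - g')) (Fin (d - g)) ℂ)
    (k : ℕ) (X : OpSpace g' g n) :
    homogPart (fun w => scalarBlockDiag h' h (a w) (c w)) k X =
      blockDiag h' h (homogPart a k X) (homogPart c k X) := by
  ext r s
  obtain ⟨r, rfl⟩ := (splitEquiv h' n).surjective r
  obtain ⟨s, rfl⟩ := (splitEquiv h n).surjective s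
  rw [homogPart_apply]
  simp only [blockDiag, Matrix.reindex_apply, Matrix.submatrix_apply, Equiv.symm_apply_apply]
  rcases r with r | r <;> rcases s with s | s <;>
    simp [splitEquiv_inl, splitEquiv_inr, scalarBlockDiag, homogPart_apply]

/-! ### Normal form of the coefficients -/

/-- An orthonormal system forms the first columns of a unitary matrix. -/
lemma exists_unitary_of_orthonormal {m b : ℕ} {p : Fin m → EuclideanSpace ℂ (Fin b)}
    (hp : Orthonormal ℂ p) : ∃ (h : m ≤ b), ∃ U ∈ Matrix.unitaryGroup (Fin b) ℂ,
      ∀ j, WithLp.toLp 2 (fun r => U r (blockIndex h (Sum.inl j))) = p j := by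
  have h : m ≤ b := by
    simpa using hp.linearIndependent.fintype_card_le_finrank
  refine ⟨h, ?_⟩
  let v : Fin m ⊕ Fin (b - m) → EuclideanSpace ℂ (Fin b) := Sum.elim p 0
  have hv : Orthonormal ℂ ((Set.range Sum.inl).domRestrict v) := by
    choose f hf using fun x : Set.range (Sum.inl : Fin m → Fin m ⊕ Fin (b - m)) => x.2
    have hf' : Function.Injective f := fun x y hxy => Subtype.ext (by rw [← hf x, ← hf y, hxy])
    convert hp.comp f hf' using 1
    ext1 x
    change v x = p (f x)
    rw [← hf x]
    rfl
  obtain ⟨B, hB⟩ := hv.exists_orthonormalBasis_extension_of_card_eq (by simp [h])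
  let U : Matrix (Fin b) (Fin b) ℂ := Matrix.of fun r c => B ((blockIndex h).symm c) r
  refine ⟨U, ?_, fun j => ?_⟩
  · rw [Matrix.mem_unitaryGroup_iff']
    ext i j
    have hij := orthonormal_iff_ite.1 B.orthonormal ((blockIndex h).symm i) ((blockIndex h).symm j)
    rw [Matrix.mul_apply, Matrix.one_apply]
    simp only [EmbeddingLike.apply_eq_iff_eq] at hij
    rw [← hij, PiLp.inner_apply]
    refine Finset.sum_congr rfl fun r _ => ?_
    simp [U, mul_comm]
  · ext r
    simp [U, hB (Sum.inl j) ⟨j, rfl⟩, v]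

lemma conjTranspose_mul_mul_apply (V : Matrix (Fin d') (Fin d') ℂ) (A : Matrix (Fin d') (Fin d) ℂ)
    (U : Matrix (Fin d) (Fin d) ℂ) (i : Fin d') (j : Fin d) :
    (Vᴴ * A * U) i j = inner ℂ (WithLp.toLp 2 fun r => V r i : EuclideanSpace ℂ (Fin d'))
      (toEuclideanLin A (WithLp.toLp 2 fun r => U r j)) := by
  rw [Matrix.mul_assoc, Matrix.mul_apply, PiLp.inner_apply]
  refine Finset.sum_congr rfl fun r _ => ?_
  simp [Matrix.mul_apply, Matrix.mulVec, dotProduct, mul_comm]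

/-- The coefficients of an NC ball map fixing `0` are simultaneously unitarily equivalent to
those of a direct sum `x ⊕ c`. -/
lemma IsNCBallMap.exists_coeff_eq {f : NCFun g' g d' d} (hf : IsNCBallMap f) (h0 : FixesZero f)
    {a : FreeMonoid (Fin g' × Fin g) → Matrix (Fin d') (Fin d) ℂ} {ε : ℝ} (hε : 0 < ε)
    (ha : HasSeries f a ε) (hg' : 0 < g') (hg : 0 < g) :
    ∃ (hd' : g' ≤ d') (hd : g ≤ d), ∃ U ∈ Matrix.unitaryGroup (Fin d) ℂ,
      ∃ V ∈ Matrix.unitaryGroup (Fin d') ℂ,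
      ∃ c : FreeMonoid (Fin g' × Fin g) → Matrix (Fin (d' - g')) (Fin (d - g)) ℂ,
        ∀ w, Vᴴ * a w * U = scalarBlockDiag hd' hd (letterCoeff w) (c w) := by
  obtain ⟨p, q, hp, hq, hpq, hqp, hp0, hq0⟩ :=
    hf.exists_orthonormal hε ha (coeff_one_eq_zero h0 hε ha) hg' hg
  obtain ⟨hd, U, hU, hUp⟩ := exists_unitary_of_orthonormal hp
  obtain ⟨hd', V, hV, hVq⟩ := exists_unitary_of_orthonormal hq
  refine ⟨hd', hd, U, hU, V, hV, fun w => (Vᴴ * a w * U).submatrix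
    (fun i => blockIndex hd' (Sum.inr i)) fun j => blockIndex hd (Sum.inr j), fun w => ?_⟩
  have horthV : ∀ i k, i ≠ k → inner ℂ (WithLp.toLp 2 fun r => V r i : EuclideanSpace ℂ (Fin d'))
      (WithLp.toLp 2 fun r => V r k) = 0 := by
    intro i k hik
    have h := conjTranspose_mul_mul_apply V 1 V i k
    rw [Matrix.mul_one, ← Matrix.star_eq_conjTranspose, Matrix.mem_unitaryGroup_iff'.1 hV,
      Matrix.one_apply_ne hik] at h
    simpa using h.symm
  have horthU : ∀ i k, i ≠ k → inner ℂ (WithLp.toLp 2 fun r => U r i : EuclideanSpace ℂ (Fin d))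
      (WithLp.toLp 2 fun r => U r k) = 0 := by
    intro i k hik
    have h := conjTranspose_mul_mul_apply U 1 U i k
    rw [Matrix.mul_one, ← Matrix.star_eq_conjTranspose, Matrix.mem_unitaryGroup_iff'.1 hU,
      Matrix.one_apply_ne hik] at h
    simpa using h.symm
  obtain ⟨l, rfl⟩ := FreeMonoid.ofList.surjective w
  ext i j
  obtain ⟨i, rfl⟩ := (blockIndex hd').surjective i
  obtain ⟨j, rfl⟩ := (blockIndex hd).surjective j
  rcases i with i | i <;> rcases j with j | j
  · rw [conjTranspose_mul_mul_apply, hUp, hVq]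
    simp only [scalarBlockDiag, Matrix.reindex_apply, Matrix.submatrix_apply,
      Equiv.symm_apply_apply, Matrix.fromBlocks_apply₁₁, letterCoeff_ofList_apply]
    by_cases h : l = [(i, j)]
    · rw [if_pos h, h, hpq, inner_self_eq_norm_sq_to_K, hq.1]
      simp
    · rw [if_neg h]
      by_cases h' : ∃ k, l = [(k, j)]
      · obtain ⟨k, rfl⟩ := h'
        rw [hpq]
        exact hq.2 fun (hik : i = k) => h (hik ▸ rfl)
      · push Not at h'
        rw [hp0 j l h', inner_zero_right]
  · rw [conjTranspose_mul_mul_apply, hVq, ← inner_toEuclideanLin_conjTranspose]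
    simp only [scalarBlockDiag, Matrix.reindex_apply, Matrix.submatrix_apply,
      Equiv.symm_apply_apply, Matrix.fromBlocks_apply₁₂, Matrix.zero_apply]
    by_cases h' : ∃ k, l = [(i, k)]
    · obtain ⟨k, rfl⟩ := h'
      rw [hqp, ← hUp]
      exact horthU _ _ (by simp)
    · push Not at h'
      rw [hq0 i l h', inner_zero_left]
  · rw [conjTranspose_mul_mul_apply, hUp]
    simp only [scalarBlockDiag, Matrix.reindex_apply, Matrix.submatrix_apply,
      Equiv.symm_apply_apply, Matrix.fromBlocks_apply₂₁, Matrix.zero_apply]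
    by_cases h' : ∃ k, l = [(k, j)]
    · obtain ⟨k, rfl⟩ := h'
      rw [hpq, ← hVq]
      exact horthV _ _ (by simp)
    · push Not at h'
      rw [hp0 j l h', inner_zero_right]
  · simp [scalarBlockDiag]

/-! ### From the coefficients to the map -/

/-- The lower right corner of `(V ⊗ I)^* f (U ⊗ I)` serves as the second summand; the rest agrees
with `x` near `0`, hence on the whole ball. -/
lemma IsNCBallMap.exists_blockDiag_form {f : NCFun g' g d' d} (hf : IsNCBallMap f)
    (h0 : FixesZero f) (hg' : 0 < g') (hg : 0 < g) :
    ∃ (hd' : g' ≤ d') (hd : g ≤ d), ∃ U ∈ Matrix.unitaryGroup (Fin d) ℂ,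
      ∃ V ∈ Matrix.unitaryGroup (Fin d') ℂ, ∃ fTilde : NCFun g' g (d' - g') (d - g),
        IsNCAnalytic fTilde ∧ IsContractionValued fTilde ∧ FixesZero fTilde ∧
        ∀ (n : ℕ) (X : OpSpace g' g n), X ∈ openBall g' g n →
          f n X = ampl V n * blockDiag hd' hd X (fTilde n X) * (ampl U n)ᴴ := by
  obtain ⟨a, ε, hε, ha⟩ := hf.analytic.series
  obtain ⟨hd', hd, U, hU, V, hV, c, hc⟩ := hf.exists_coeff_eq h0 hε ha hg' hg
  have hsum : ∀ (K n : ℕ) (X : OpSpace g' g n), 2 ≤ K →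
      amplLin Vᴴ U n (∑ k ∈ Finset.range K, homogPart a k X) =
        blockDiag hd' hd X (∑ k ∈ Finset.range K, homogPart c k X) := by
    intro K n X hK
    have h : ∀ k, amplLin Vᴴ U n (homogPart a k X) =
        blockDiagLin hd' hd n (homogPart letterCoeff k X, homogPart c k X) := fun k => by
      rw [← homogPart_mul_mul, funext hc, homogPart_scalarBlockDiag, blockDiagLin_apply]
    rw [map_sum, Finset.sum_congr rfl fun k _ => h k, ← map_sum, blockDiagLin_apply,
      Prod.fst_sum, Prod.snd_sum, sum_homogPart_letterCoeff hK]
  let T : ∀ n, OpSpace d' d n →ₗ[ℂ] OpSpace (d' - g') (d - g) n :=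
    fun n => cornerLin hd' hd n ∘ₗ amplLin Vᴴ U n
  -- `R` keeps the part of `V^* Y U` outside of the lower right corner.
  let R : ∀ n, OpSpace d' d n →ₗ[ℂ] OpSpace d' d n := fun n =>
    amplLin Vᴴ U n - blockDiagLin hd' hd n ∘ₗ LinearMap.inr ℂ _ _ ∘ₗ T n
  have hTcont : ∀ n, Continuous (T n) := fun n => (T n).continuous_of_finiteDimensional
  have hRcont : ∀ n, Continuous (R n) := fun n => (R n).continuous_of_finiteDimensional
  have hsplit : ∀ (n : ℕ) (X : OpSpace g' g n) (Y : OpSpace (d' - g') (d - g) n),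
      blockDiag hd' hd X Y = blockDiag hd' hd X 0 + blockDiag hd' hd 0 Y := by
    intro n X Y
    have := (blockDiagLin hd' hd n).map_add (X, 0) (0, Y)
    simpa [blockDiagLin_apply] using this
  have hRsum : ∀ (K n : ℕ) (X : OpSpace g' g n), 2 ≤ K →
      R n (∑ k ∈ Finset.range K, homogPart a k X) = blockDiag hd' hd X 0 := by
    intro K n X hK
    simp only [R, T, LinearMap.sub_apply, LinearMap.comp_apply, hsum K n X hK,
      cornerLin_blockDiag, LinearMap.inr_apply, blockDiagLin_apply]
    rw [hsplit, add_sub_cancel_right]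
  have hRf : ∀ (n : ℕ) (X : OpSpace g' g n), X ∈ openBall g' g n →
      R n (f n X) = blockDiag hd' hd X 0 := by
    intro n X hX
    have hlin : ∀ z : ℂ, blockDiag hd' hd (z • X) 0 = z • blockDiag hd' hd X 0 := by
      intro z
      have := (blockDiagLin hd' hd n).map_smul z (X, 0)
      simpa [blockDiagLin_apply] using this
    have h := eqOn_line (X := X) (F := fun z => R n (f n (z • X)))
      (q := fun z => z • blockDiag hd' hd X 0)
      ((R n).toContinuousLinearMap.differentiable.comp_differentiableOn
        (hf.analytic.differentiableOn_line X)) (by fun_prop) hε (fun z hz hz' => by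
          refine tendsto_nhds_unique (((hRcont n).tendsto _).comp (ha n (z • X) hz hz'))
            (tendsto_const_nhds.congr' ?_)
          filter_upwards [Filter.eventually_ge_atTop 2] with K hK
          rw [Function.comp_apply, hRsum K n _ hK, hlin]) (z := 1) (by rw [one_smul]; exact hX)
    simpa using h
  refine ⟨hd', hd, U, hU, V, hV, fun n X => T n (f n X), ⟨⟨c, ε, hε, fun n X hX hXε => ?_⟩,
    fun n M W b hW hWc hb hbd => ?_⟩, fun n X hX => ?_, fun n => ?_, fun n X hX => ?_⟩
  · refine (((hTcont n).tendsto _).comp (ha n X hX hXε)).congr' ?_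
    filter_upwards [Filter.eventually_ge_atTop 2] with K hK
    simp only [Function.comp_apply, T, LinearMap.comp_apply, hsum K n X hK, cornerLin_blockDiag]
  · obtain ⟨h1, h2⟩ := hf.analytic.comp n M W b hW hWc hb hbd
    exact ⟨(T n).toContinuousLinearMap.differentiable.comp_differentiableOn h1,
      fun h3 h4 => (hTcont n).comp_continuousOn (h2 h3 h4)⟩
  · exact ((norm_cornerLin_le hd' hd _).trans
      (norm_amplLin_le (conjTranspose_mem_unitaryGroup hV) hU _)).trans (hf.contractive n X hX)
  · simp only [h0 n, map_zero]
  · have h := hRf n X hX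
    simp only [R, LinearMap.sub_apply, LinearMap.comp_apply, LinearMap.inr_apply,
      blockDiagLin_apply] at h
    rw [ampl_conjTranspose, ← amplLin_apply, hsplit, ← h]
    change f n X = amplLin V Uᴴ n (amplLin Vᴴ U n (f n X) - blockDiag hd' hd 0 (T n (f n X)) +
      blockDiag hd' hd 0 (T n (f n X)))
    rw [sub_add_cancel, amplLin_amplLin_conjTranspose hV hU]

/-- Direct sums with the identity are NC ball maps fixing `0`. -/
lemma isNCBallMap_of_blockDiag_form {f : NCFun g' g d' d} (hd' : g' ≤ d') (hd : g ≤ d)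
    {U : Matrix (Fin d) (Fin d) ℂ} (hU : U ∈ Matrix.unitaryGroup (Fin d) ℂ)
    {V : Matrix (Fin d') (Fin d') ℂ} (hV : V ∈ Matrix.unitaryGroup (Fin d') ℂ)
    {fTilde : NCFun g' g (d' - g') (d - g)} (han : IsNCAnalytic fTilde)
    (hcontr : IsContractionValued fTilde) (h0 : FixesZero fTilde)
    (hform : ∀ (n : ℕ) (X : OpSpace g' g n), X ∈ openBall g' g n →
      f n X = ampl V n * blockDiag hd' hd X (fTilde n X) * (ampl U n)ᴴ) :
    IsNCBallMap f ∧ FixesZero f := by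
  let S : ∀ n, (OpSpace g' g n × OpSpace (d' - g') (d - g) n) →ₗ[ℂ] OpSpace d' d n :=
    fun n => amplLin V Uᴴ n ∘ₗ blockDiagLin hd' hd n
  have hS : ∀ n X, X ∈ openBall g' g n → f n X = S n (X, fTilde n X) := fun n X hX => by
    rw [hform n X hX, ampl_conjTranspose]
    rfl
  have hnorm : ∀ n X, X ∈ openBall g' g n → ‖f n X‖ = ‖blockDiag hd' hd X (fTilde n X)‖ :=
    fun n X hX => by rw [hS n X hX]; exact norm_amplLin hV hU _
  have hScont : ∀ n, Continuous (S n) := fun n => (S n).continuous_of_finiteDimensional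
  have hle : IsContractionValued f := fun n X hX => by
    rw [hnorm n X hX]
    exact norm_blockDiag_le_one hd' hd (le_of_lt hX) (hcontr n X hX)
  refine ⟨⟨⟨?_, fun n M W b hW hWc hb hbd => ?_⟩, hle, fun n X hX t L hL => ?_⟩, fun n => ?_⟩
  · obtain ⟨c, ε, hε, hc⟩ := han.series
    refine ⟨fun w => V * scalarBlockDiag hd' hd (letterCoeff w) (c w) * Uᴴ, ε, hε,
      fun n X hX hXε => ?_⟩
    rw [hS n X hX]
    refine (((hScont n).tendsto _).comp
      (tendsto_const_nhds.prodMk_nhds (hc n X hX hXε))).congr' ?_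
    filter_upwards [Filter.eventually_ge_atTop 2] with K hK
    have h : ∀ k, homogPart (fun w => V * scalarBlockDiag hd' hd (letterCoeff w) (c w) * Uᴴ) k X =
        S n (homogPart letterCoeff k X, homogPart c k X) := fun k => by
      rw [homogPart_mul_mul, homogPart_scalarBlockDiag]
      rfl
    rw [Finset.sum_congr rfl fun k _ => h k, ← map_sum, Function.comp_apply]
    congr 1
    exact Prod.ext (by rw [Prod.fst_sum, sum_homogPart_letterCoeff hK]) (by rw [Prod.snd_sum])
  · obtain ⟨h1, h2⟩ := han.comp n M W b hW hWc hb hbd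
    refine ⟨?_, fun h3 h4 => ?_⟩
    · exact ((S n).toContinuousLinearMap.differentiable.comp_differentiableOn
        (hbd.prodMk h1)).congr fun w hw => hS n _ (hb hw)
    · exact ((hScont n).comp_continuousOn (h3.prodMk (h2 h3 h4))).congr
        fun w hw => hS n _ (h4 hw)
  -- Near the boundary `f` is squeezed between `‖X‖` and `1`.
  · have hball : ∀ r ∈ Set.Ioo (0 : ℝ) 1,
        ‖((r : ℂ) * Complex.exp (Complex.I * (t : ℂ))) • X‖ = r := fun r hr => by
      rw [norm_smul, hX, norm_mul, mul_comm Complex.I, Complex.norm_exp_ofReal_mul_I,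
        Complex.norm_real, Real.norm_of_nonneg hr.1.le, mul_one, mul_one]
    refine le_antisymm (le_of_tendsto hL.norm ?_) (le_of_tendsto_of_tendsto
      (Filter.tendsto_id.mono_left nhdsWithin_le_nhds) hL.norm ?_)
    · filter_upwards [Ioo_mem_nhdsLT (zero_lt_one (α := ℝ))] with r hr
      exact hle n _ ((hball r hr).trans_lt hr.2)
    · filter_upwards [Ioo_mem_nhdsLT (zero_lt_one (α := ℝ))] with r hr
      rw [hnorm n _ ((hball r hr).trans_lt hr.2)]
      exact (hball r hr).ge.trans (norm_le_norm_blockDiag hd' hd _ _)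
  · rw [hS n 0 (by simp [openBall]), h0 n]
    exact map_zero (S n)

end NCBall

end

theorem mainTheorem1 {g' g d' d : ℕ} (hg' : 0 < g') (hg : 0 < g)
    (h : NCBall.NCFun g' g d' d) :
    (NCBall.IsNCBallMap h ∧ NCBall.FixesZero h) ↔
      ∃ (hd' : g' ≤ d') (hd : g ≤ d),
        ∃ U ∈ Matrix.unitaryGroup (Fin d) ℂ, ∃ V ∈ Matrix.unitaryGroup (Fin d') ℂ,
          ∃ hTilde : NCBall.NCFun g' g (d' - g') (d - g),
            NCBall.IsNCAnalytic hTilde ∧ NCBall.IsContractionValued hTilde ∧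
            NCBall.FixesZero hTilde ∧
            ∀ (n : ℕ) (X : NCBall.OpSpace g' g n), X ∈ NCBall.openBall g' g n →
              h n X = NCBall.ampl V n * NCBall.blockDiag hd' hd X (hTilde n X) *
                (NCBall.ampl U n).conjTranspose := by
  constructor
  · rintro ⟨hf, h0⟩
    exact hf.exists_blockDiag_form h0 hg' hg
  · rintro ⟨hd', hd, U, hU, V, hV, hTilde, han, hcontr, h0, hform⟩
    exact NCBall.isNCBallMap_of_blockDiag_form hd' hd hU hV han hcontr h0 hform
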